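/- Let $X$ be a complex Hilbert space and let $A:D(A)\subset X\to X$ generate a strongly stable strongly continuous semigroup on $X$ (that is, $T(t)x\to0$ as $t\to\infty$ for every $x\in X$). Assume that $\sigma(A)\cap i\mathbb R=\{i\omega_k\}_{k\in I}$, where $I$ is a (finite or countable, possibly empty) index set and the points are uniformly separated: $\inf_{k\ne l}|\omega_k-\omega_l|>0$. Let $\beta,\gamma\ge0$ with $\alpha:=\beta+\gamma\ge1$, and assume that for some $M_A>0$ and $\varepsilon_A>0$ $$\sup_{0<|\omega-\omega_k|\le\varepsilon_A}|\omega-\omega_k|^{\alpha}\,\|R(i\omega,A)\|\le M_A\quad\text{for all }k\in I,$$ where the supremum is over those $\omega$ with $i\omega\in\rho(A)$, and $\|R(i\omega,A)\|\le M_A$ whenever $|\omega-\omega_k|>\varepsilon_A$ for all $k\in I$. Here $R(\lambda,A)=(\lambda-A)^{-1}$. Then there is $\delta>0$ with the following property. Let $Y$ be a complex Banach space (for example $Y=\mathbb C^p$), and let $B\in L(Y,X)$ and $C\in L(X,Y)$ be such that for every $k\in I$ one has $\operatorname{ran}(B)\subset\operatorname{ran}((i\omega_k-A)^{\beta})$ and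 $\operatorname{ran}(C^*)\subset\operatorname{ran}((-i\omega_k-A^*)^{\gamma})$, the operators $(i\omega_k-A)^{-\beta}B$ and $(-i\omega_k-A^*)^{-\gamma}C^*$ are bounded, and $$\|B\|<\delta,\quad \|C\|<\delta,\quad \|(i\omega_k-A)^{-\beta}B\|<\delta,\quad \|(-i\omega_k-A^*)^{-\gamma}C^*\|<\delta .$$ (The powers are the fractional powers of the sectorial operators $i\omega_k-A$ and $-i\omega_k-A^*$, and $C^*$ maps the dual of $Y$ into $X\cong X^*$.) Then $$\{\lambda\in\mathbb C:\operatorname{Re}\lambda\ge0\}\setminus\{i\omega_k\}_{k\in I}\subset\rho(A+BC),$$ no $i\omega_k$, $k\in I$, is an eigenvalue of $A+BC$, and for every $\lambda$ with $\operatorname{Re}\lambda\ge0$, $\lambda\notin\{i\omega_k\}_{k\in I}$, one has $\lambda\in\rho(A)$, the operator $I-CR(\lambda,A)B$ is boundedly invertible, and $$\sup_{\operatorname{Re}\lambda\ge0,\ \lambda\notin\{i\omega_k\}_{k}}\|(I-CR(\lambda,A)B)^{-1}\|<\infty .$$ -/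

import Mathlib

open Filter Topology MeasureTheory Set

noncomputable section

namespace OpSemigroup

/-! ### Unbounded operators: resolvent set, resolvent, spectrum, point spectrum -/

section Operators

variable {X : Type*} [NormedAddCommGroup X] [NormedSpace ℂ X]

/-- The operator `z - A`, with domain `D(A)`. -/
def shift (z : ℂ) (A : X →ₗ.[ℂ] X) : X →ₗ.[ℂ] X :=
  (z • (LinearMap.id : X →ₗ[ℂ] X)) +ᵥ (-A)

/-- The perturbed operator `A + P` with `P` bounded, with domain `D(A)`. -/
def addBounded (A : X →ₗ.[ℂ] X) (P : X →L[ℂ] X) : X →ₗ.[ℂ] X :=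
  (P : X →ₗ[ℂ] X) +ᵥ A

/-- `R` is a bounded two-sided inverse of `z - A : D(A) → X`. -/
def IsResolventAt (A : X →ₗ.[ℂ] X) (z : ℂ) (R : X →L[ℂ] X) : Prop :=
  (∀ x : X, ∃ u : A.domain, (u : X) = R x ∧ z • (u : X) - A u = x) ∧
  (∀ u : A.domain, R (z • (u : X) - A u) = u)

/-- The resolvent set `ρ(A)`. -/
def resolventSet (A : X →ₗ.[ℂ] X) : Set ℂ := {z | ∃ R : X →L[ℂ] X, IsResolventAt A z R}

/-- The spectrum `σ(A)`. -/
def spectrum (A : X →ₗ.[ℂ] X) : Set ℂ := (resolventSet A)ᶜ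

/-- The point spectrum `σ_p(A)`, the set of eigenvalues. -/
def pointSpectrum (A : X →ₗ.[ℂ] X) : Set ℂ :=
  {z | ∃ u : A.domain, (u : X) ≠ 0 ∧ A u = z • (u : X)}

open Classical in
/-- The resolvent operator `R(z, A) = (z - A)⁻¹` for `z ∈ ρ(A)` (and `0` for other `z`). -/
def resolvent (A : X →ₗ.[ℂ] X) (z : ℂ) : X →L[ℂ] X :=
  if h : z ∈ resolventSet A then Classical.choose h else 0

theorem resolvent_spec {A : X →ₗ.[ℂ] X} {z : ℂ} (h : z ∈ resolventSet A) :
    IsResolventAt A z (resolvent A z) := by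
  unfold resolvent
  rw [dif_pos h]
  exact Classical.choose_spec h

/-! ### Strongly continuous semigroups -/

/-- `T` (restricted to `[0, ∞)`) is a strongly continuous semigroup of bounded operators. -/
structure IsC0Semigroup (T : ℝ → X →L[ℂ] X) : Prop where
  map_zero : T 0 = 1
  map_add : ∀ s t : ℝ, 0 ≤ s → 0 ≤ t → T (s + t) = (T s).comp (T t)
  tendsto_zero : ∀ x : X, Tendsto (fun t => T t x) (𝓝[>] 0) (𝓝 x)

/-- `A` is the (infinitesimal) generator of `T`: `x ∈ D(A)` and `A x = y` if and only if
`(T(t) x - x) / t → y` as `t → 0+`. -/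
def IsGenerator (T : ℝ → X →L[ℂ] X) (A : X →ₗ.[ℂ] X) : Prop :=
  ∀ x y : X, (x, y) ∈ A.graph ↔
    Tendsto (fun t : ℝ => ((t : ℂ)⁻¹) • (T t x - x)) (𝓝[>] 0) (𝓝 y)

/-- Strong stability: `T(t) x → 0` as `t → ∞`, for every `x`. -/
def IsStronglyStable (T : ℝ → X →L[ℂ] X) : Prop :=
  ∀ x : X, Tendsto (fun t => T t x) atTop (𝓝 0)

/-- Uniform boundedness on `[0, ∞)`. -/
def IsUniformlyBounded (T : ℝ → X →L[ℂ] X) : Prop :=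
  ∃ M : ℝ, ∀ t : ℝ, 0 ≤ t → ‖T t‖ ≤ M

/-! ### Fractional powers -/

/-- `(1 / Γ(β)) ∫₀^∞ t^(β-1) e^(-ε t) S(t) z dt`. If `-G` generates the uniformly bounded semigroup
`S`, then this is `(ε + G)^(-β) z`, for `ε, β > 0`. -/
def negPowShift (S : ℝ → X →L[ℂ] X) (ε β : ℝ) (z : X) : X :=
  (((Real.Gamma β)⁻¹ : ℝ) : ℂ) •
    ∫ t in Ioi (0 : ℝ), ((t ^ (β - 1) * Real.exp (-(ε * t)) : ℝ) : ℂ) • S t z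

/-- The graph of the fractional power `G ^ β`, `β ≥ 0`, of an operator `G` for which `-G` generates a
uniformly bounded strongly continuous semigroup `S` (necessarily unique): `IsFracPow G β x y` means
`x ∈ D(G ^ β)` and `G ^ β x = y`.

`G ^ 0` is the identity. For `β > 0` and `ε > 0`, `(ε + G)^β` is the inverse of the bounded injective
operator `(ε + G)^(-β)`, which is given by the integral `negPowShift S ε β`, and
`G ^ β = s-lim_{ε → 0+} (ε + G)^β`: in the formula below, `z ε = (ε + G)^β x`. -/
def IsFracPow (G : X →ₗ.[ℂ] X) (β : ℝ) (x y : X) : Prop :=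
  (β = 0 ∧ x = y) ∨
  (0 < β ∧ ∃ S : ℝ → X →L[ℂ] X,
    IsC0Semigroup S ∧ IsUniformlyBounded S ∧ IsGenerator S (-G) ∧
    ∃ z : ℝ → X, (∀ ε : ℝ, 0 < ε → negPowShift S ε β (z ε) = x) ∧
      Tendsto z (𝓝[>] 0) (𝓝 y))

end Operators

/-! ### The operators `(iω - A)^(-β) B` and `(-iω - A*)^(-γ) C*` -/

section Components

variable {X : Type*} [NormedAddCommGroup X] [InnerProductSpace ℂ X] [CompleteSpace X]
variable {Y : Type*} [NormedAddCommGroup Y] [NormedSpace ℂ Y]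

/-- The adjoint `C* : Y* → X` of `C ∈ L(X, Y)`, where the dual of the Hilbert space `X` is identified
with `X` through the Riesz representation: `⟪C* f, x⟫ = f (C x)`. It is conjugate-linear in `f`. -/
def dualAdjoint (C : X →L[ℂ] Y) (f : StrongDual ℂ Y) : X :=
  (InnerProductSpace.toDual ℂ X).symm (f.comp C)

theorem inner_dualAdjoint (C : X →L[ℂ] Y) (f : StrongDual ℂ Y) (x : X) :
    inner ℂ (dualAdjoint C f) x = f (C x) := by
  simp [dualAdjoint]

/-- If `Y` is a Hilbert space (for instance `ℂ^p`) then `C*` is the Hilbert space adjoint of `C`. -/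
theorem dualAdjoint_toDual {H : Type*} [NormedAddCommGroup H] [InnerProductSpace ℂ H]
    [CompleteSpace H] (C : X →L[ℂ] H) (h : H) :
    dualAdjoint C (InnerProductSpace.toDual ℂ H h) = ContinuousLinearMap.adjoint C h := by
  refine ext_inner_right ℂ fun x => ?_
  rw [inner_dualAdjoint, ContinuousLinearMap.adjoint_inner_left]
  simp

/-- `ran(B) ⊆ ran((iω - A)^β)`, the operator `(iω - A)^(-β) B` is bounded, and it is `D`. -/
def IsNegPowComp (A : X →ₗ.[ℂ] X) (ω β : ℝ) (B D : Y →L[ℂ] X) : Prop :=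
  ∀ y : Y, IsFracPow (shift ((ω : ℂ) * Complex.I) A) β (D y) (B y)

/-- `ran(C*) ⊆ ran((-iω - A*)^γ)`, the operator `(-iω - A*)^(-γ) C*` is bounded, and it is `D`. -/
def IsNegPowCompAdjoint (A : X →ₗ.[ℂ] X) (ω γ : ℝ) (C : X →L[ℂ] Y)
    (D : StrongDual ℂ Y →SL[starRingEnd ℂ] X) : Prop :=
  ∀ f : StrongDual ℂ Y,
    IsFracPow (shift (-((ω : ℂ) * Complex.I)) A.adjoint) γ (D f) (dualAdjoint C f)

end Components

end OpSemigroup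

end

/-!
The whole statement reduces to a small-gain estimate: `‖C R(λ, A) B‖ ≤ 1 / 2` for every `λ` in the closed
right half-plane outside the points `iω k`. The Neumann series then gives the uniform bound on
`(I - C R(λ, A) B)⁻¹`, the Sherman–Morrison–Woodbury formula (`IsResolventAt.addBounded`) gives
`λ ∈ ρ(A + BC)`, and an eigenvector `u` of `A + BC` at `iω k` satisfies
`(I - C R B) C u = C μ R u → 0` with `R = R(iω k + μ, A)`, `μ → 0+`, so `C u = 0` and
`u = lim μ R u = 0` (`notMem_pointSpectrum_addBounded`).

The resolvent bounds on the imaginary axis extend to the half-plane by the resolvent identity and the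
Hille–Yosida estimate `‖R(λ)‖ ≤ M₀ / Re λ`; near `iω k` this uses `α ≥ 1`
(`norm_resolvent_le_near`, `norm_resolvent_le_far`). Away from the points `iω k` the gain estimate is
then immediate. Near `iω k`, put `G = iω k - A`, `μ = λ - iω k`, so that `R(λ, A) = (μ + G)⁻¹` has norm
`O(|μ| ^ (-α))`, and let `b = B y = G ^ β d`, `c = C* f = (G*) ^ γ e`. The iterated resolvent identity with
`J = (1 + G)⁻¹` leaves only `⟪c, R J ^ N b⟫` to estimate, which is the limit as `ε → 0+` of
`⟪e, R J ^ N (ε + G) ^ α d⟫` (`exists_bound_inner_resolvent`). The operators `R J ^ N (ε + G) ^ α` are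
bounded uniformly in `μ` and `ε ≤ |μ|` (`exists_bound_resolvent_mul_negPow`): powers `G ^ n` turn into
`μ ^ n` up to bounded terms, and for the remaining fraction the integral of the semigroup that defines
`(ε + G) ^ (-κ)` is split at `t = 1 / |μ|` (`IsGenerator.exists_negPow_eq_add`), which is the moment
inequality. The condition `α ≥ 1` makes the term `|μ| ^ (n - κ)`, `n = ⌊α⌋ ≥ 1 ≥ κ`, bounded.

The fractional powers of `G` and `G*` are given by some semigroups generated by `-G` and `-G*`. That these
are `e ^ (-iω k t) T(t)` and its adjoint follows from uniqueness (`IsGenerator.unique`) and duality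
(`IsGenerator.eq_adjoint`) of bounded semigroups.
-/

noncomputable section

namespace OpSemigroup

/-! ### Graphs and resolvents of unbounded operators -/

section Resolvents

variable {X : Type*} [NormedAddCommGroup X] [NormedSpace ℂ X]

theorem mem_graph_shift {z : ℂ} {A : X →ₗ.[ℂ] X} {x y : X} :
    (x, y) ∈ (shift z A).graph ↔ (x, z • x - y) ∈ A.graph := by
  simp only [LinearPMap.mem_graph_iff]
  constructor
  · rintro ⟨u, rfl, h⟩
    refine ⟨u, rfl, ?_⟩
    rw [← h]
    change A u = z • (u : X) - (z • (u : X) + -(A u))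
    abel
  · rintro ⟨u, rfl, h⟩
    refine ⟨u, rfl, ?_⟩
    change z • (u : X) + -(A u) = y
    rw [h]; simp

theorem mem_graph_neg {A : X →ₗ.[ℂ] X} {x y : X} :
    (x, y) ∈ (-A).graph ↔ (x, -y) ∈ A.graph := by
  simp only [LinearPMap.mem_graph_iff]
  constructor
  · rintro ⟨u, rfl, h⟩
    exact ⟨u, rfl, by rw [← h]; simp⟩
  · rintro ⟨u, rfl, h⟩
    exact ⟨u, rfl, by simp [h]⟩

theorem mem_graph_neg_shift {z : ℂ} {A : X →ₗ.[ℂ] X} {x y : X} :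
    (x, y) ∈ (-(shift z A)).graph ↔ (x, y + z • x) ∈ A.graph := by
  rw [mem_graph_neg, mem_graph_shift, sub_neg_eq_add, add_comm]

theorem mem_graph_addBounded {A : X →ₗ.[ℂ] X} {P : X →L[ℂ] X} {x y : X} :
    (x, y) ∈ (addBounded A P).graph ↔ (x, y - P x) ∈ A.graph := by
  simp only [LinearPMap.mem_graph_iff]
  constructor
  · rintro ⟨u, rfl, h⟩
    refine ⟨u, rfl, ?_⟩
    rw [← h]
    change A u = (P u + A u) - P u
    abel
  · rintro ⟨u, rfl, h⟩
    refine ⟨u, rfl, ?_⟩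
    change P u + A u = y
    rw [h]; simp

theorem isResolventAt_iff {A : X →ₗ.[ℂ] X} {z : ℂ} {R : X →L[ℂ] X} :
    IsResolventAt A z R ↔ (∀ x, (R x, z • R x - x) ∈ A.graph) ∧
      ∀ u v, (u, v) ∈ A.graph → R (z • u - v) = u := by
  simp only [IsResolventAt, LinearPMap.mem_graph_iff]
  constructor
  · rintro ⟨h1, h2⟩
    refine ⟨fun x => ?_, ?_⟩
    · obtain ⟨u, hu, h⟩ := h1 x
      exact ⟨u, hu, by rw [← hu, ← h]; abel⟩
    · rintro _ _ ⟨u, rfl, rfl⟩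
      exact h2 u
  · rintro ⟨h1, h2⟩
    refine ⟨fun x => ?_, fun u => h2 _ _ ⟨u, rfl, rfl⟩⟩
    obtain ⟨u, hu, h⟩ := h1 x
    exact ⟨u, hu, by rw [h, hu]; abel⟩

namespace IsResolventAt

variable {A : X →ₗ.[ℂ] X} {z w : ℂ} {R Q : X →L[ℂ] X}

theorem mem_graph (h : IsResolventAt A z R) (x : X) : (R x, z • R x - x) ∈ A.graph :=
  (isResolventAt_iff.1 h).1 x

theorem apply_sub (h : IsResolventAt A z R) {u v : X} (huv : (u, v) ∈ A.graph) :
    R (z • u - v) = u :=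
  (isResolventAt_iff.1 h).2 u v huv

/-- The resolvent identity. -/
theorem sub_eq (hR : IsResolventAt A z R) (hQ : IsResolventAt A w Q) :
    R - Q = (w - z) • (R * Q) := by
  ext x
  have h := hR.apply_sub (hQ.mem_graph x)
  have h2 : z • Q x - (w • Q x - x) = x - (w - z) • Q x := by rw [sub_smul]; abel
  rw [h2, map_sub, map_smul] at h
  simp only [sub_apply, smul_apply, mul_apply_eq_comp]
  rw [sub_eq_iff_eq_add, ← sub_eq_iff_eq_add', h]

theorem unique (hR : IsResolventAt A z R) (hQ : IsResolventAt A z Q) : R = Q := by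
  have h := hR.sub_eq hQ
  rw [sub_self, zero_smul, sub_eq_zero] at h
  exact h

theorem commute (hR : IsResolventAt A z R) (hQ : IsResolventAt A w Q) : Commute R Q := by
  rcases eq_or_ne z w with rfl | hzw
  · rw [hR.unique hQ]
  · have h1 := hR.sub_eq hQ
    have h2 := hQ.sub_eq hR
    have h3 : (w - z) • (R * Q) = (w - z) • (Q * R) := by
      rw [← h1, ← neg_sub Q R, h2, ← neg_smul, neg_sub]
    exact smul_right_injective _ (sub_ne_zero.2 hzw.symm) h3

theorem resolvent_eq (hR : IsResolventAt A z R) : resolvent A z = R :=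
  (resolvent_spec ⟨R, hR⟩).unique hR

theorem shift (h : IsResolventAt A (z + w) R) : IsResolventAt (-(shift w A)) z R := by
  rw [isResolventAt_iff]
  refine ⟨fun x => ?_, fun u v huv => ?_⟩
  · rw [mem_graph_neg_shift]
    convert h.mem_graph x using 2
    rw [add_smul]; abel
  · rw [mem_graph_neg_shift] at huv
    have := h.apply_sub huv
    rw [add_smul] at this
    simpa using this

end IsResolventAt

end Resolvents

/-! ### Bounded strongly continuous semigroups -/

section Semigroups

variable {X : Type*} [NormedAddCommGroup X] [NormedSpace ℂ X]

/-- A strongly continuous semigroup `S` with `‖S t‖ ≤ M` for `t ≥ 0`. -/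
structure IsBoundedSemigroup (S : ℝ → X →L[ℂ] X) (M : ℝ) : Prop where
  semigroup : IsC0Semigroup S
  bound : ∀ t : ℝ, 0 ≤ t → ‖S t‖ ≤ M

theorem IsC0Semigroup.tendsto_zero' {T : ℝ → X →L[ℂ] X} (hT : IsC0Semigroup T) (x : X) :
    Tendsto (fun t => T t x) (𝓝[≥] 0) (𝓝 x) := by
  have h : ContinuousWithinAt (fun t => T t x) (Ioi 0) 0 := by
    simpa [ContinuousWithinAt, hT.map_zero] using hT.tendsto_zero x
  have h2 := continuousWithinAt_Ioi_iff_Ici.1 h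
  simpa [ContinuousWithinAt, hT.map_zero] using h2

theorem IsC0Semigroup.exists_local_bound [CompleteSpace X] {T : ℝ → X →L[ℂ] X}
    (hT : IsC0Semigroup T) :
    ∃ δ : ℝ, 0 < δ ∧ ∃ K : ℝ, 1 ≤ K ∧ ∀ t, 0 ≤ t → t ≤ δ → ‖T t‖ ≤ K := by
  by_contra! hcon
  have h1 : ∀ n : ℕ, ∃ t : ℝ, 0 ≤ t ∧ t ≤ 1 / ((n : ℝ) + 1) ∧ (n : ℝ) + 1 < ‖T t‖ := fun n =>
    hcon _ (by positivity) _ (by linarith [n.cast_nonneg (α := ℝ)])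
  choose t ht0 ht1 ht2 using h1
  have hlim : Tendsto t atTop (𝓝[≥] 0) := by
    refine tendsto_nhdsWithin_iff.2 ⟨?_, Eventually.of_forall ht0⟩
    exact squeeze_zero ht0 ht1 tendsto_one_div_add_atTop_nhds_zero_nat
  obtain ⟨K, hK⟩ := banach_steinhaus (g := fun n => T (t n)) fun x => by
    obtain ⟨C, hC⟩ := ((hT.tendsto_zero' x).comp hlim).norm.bddAbove_range
    exact ⟨C, fun n => hC ⟨n, rfl⟩⟩
  obtain ⟨n, hn⟩ := exists_nat_gt K
  have := hK n
  linarith [ht2 n]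

theorem IsC0Semigroup.exists_bound_Icc [CompleteSpace X] {T : ℝ → X →L[ℂ] X}
    (hT : IsC0Semigroup T) (N : ℝ) : ∃ K : ℝ, ∀ t, 0 ≤ t → t ≤ N → ‖T t‖ ≤ K := by
  obtain ⟨δ, hδ, K, hK, h⟩ := hT.exists_local_bound
  have key : ∀ n : ℕ, ∀ t, 0 ≤ t → t ≤ n * δ → ‖T t‖ ≤ K ^ (n + 1) := by
    intro n
    induction n with
    | zero =>
      intro t h0 h1
      rw [zero_add, pow_one]
      exact h t h0 (by simp at h1; linarith)
    | succ n ih =>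
      intro t h0 h1
      rcases le_total t δ with htδ | htδ
      · exact (h t h0 htδ).trans (le_self_pow₀ hK (by omega))
      · have h2 : T t = (T δ).comp (T (t - δ)) := by
          rw [← hT.map_add _ _ hδ.le (by linarith)]; congr 1; ring
        rw [h2, pow_succ']
        refine (ContinuousLinearMap.opNorm_comp_le _ _).trans ?_
        refine mul_le_mul (h δ hδ.le le_rfl) (ih _ (by linarith) ?_) (norm_nonneg _) (by linarith)
        push_cast at h1; linarith
  obtain ⟨n, hn⟩ := exists_nat_gt (N / δ)
  refine ⟨K ^ (n + 1), fun t h0 h1 => key n t h0 ?_⟩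
  rw [div_lt_iff₀ hδ] at hn
  linarith

/-- A strongly stable semigroup is uniformly bounded, by the uniform boundedness principle. -/
theorem IsStronglyStable.exists_isBoundedSemigroup [CompleteSpace X] {T : ℝ → X →L[ℂ] X}
    (hT : IsC0Semigroup T) (hs : IsStronglyStable T) : ∃ M : ℝ, 1 ≤ M ∧ IsBoundedSemigroup T M := by
  obtain ⟨K, hK⟩ := banach_steinhaus (g := fun t : {t : ℝ // 0 ≤ t} => T t) fun x => by
    obtain ⟨N, hN⟩ := eventually_atTop.1
      ((hs x).norm.eventually (gt_mem_nhds (by simp : ‖(0 : X)‖ < 1)))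
    obtain ⟨K, hK⟩ := hT.exists_bound_Icc N
    refine ⟨max 1 (K * ‖x‖), fun ⟨t, ht⟩ => ?_⟩
    rcases le_total N t with h | h
    · exact (hN t h).le.trans (le_max_left _ _)
    · exact ((T t).le_of_opNorm_le (hK t ht h) x).trans (le_max_right _ _)
  exact ⟨max 1 K, le_max_left _ _, hT, fun t ht => (hK ⟨t, ht⟩).trans (le_max_right _ _)⟩

namespace IsBoundedSemigroup

variable {S : ℝ → X →L[ℂ] X} {M : ℝ}

theorem nonneg (hS : IsBoundedSemigroup S M) : 0 ≤ M :=
  (norm_nonneg _).trans (hS.bound 0 le_rfl)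

theorem norm_apply_le (hS : IsBoundedSemigroup S M) {t : ℝ} (ht : 0 ≤ t) (x : X) :
    ‖S t x‖ ≤ M * ‖x‖ :=
  (S t).le_of_opNorm_le (hS.bound t ht) x

theorem apply_add (hS : IsBoundedSemigroup S M) {s t : ℝ} (hs : 0 ≤ s) (ht : 0 ≤ t) (x : X) :
    S (s + t) x = S s (S t x) := by
  rw [hS.semigroup.map_add s t hs ht]; rfl

theorem apply_comm (hS : IsBoundedSemigroup S M) {s t : ℝ} (hs : 0 ≤ s) (ht : 0 ≤ t) (x : X) :
    S s (S t x) = S t (S s x) := by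
  rw [← hS.apply_add hs ht, add_comm, hS.apply_add ht hs]

theorem norm_apply_sub_le (hS : IsBoundedSemigroup S M) {s t : ℝ} (hs : 0 ≤ s) (ht : 0 ≤ t)
    (x : X) : ‖S t x - S s x‖ ≤ M * ‖S |t - s| x - x‖ := by
  wlog h : s ≤ t generalizing s t
  · rw [norm_sub_rev, abs_sub_comm]
    exact this ht hs (le_of_not_ge h)
  · have h1 : S t x - S s x = S s (S (t - s) x - x) := by
      rw [map_sub, ← hS.apply_add hs (by linarith)]
      congr 3; ring
    rw [h1, abs_of_nonneg (by linarith)]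
    exact hS.norm_apply_le hs _

theorem continuousOn (hS : IsBoundedSemigroup S M) (x : X) :
    ContinuousOn (fun t => S t x) (Ici 0) := by
  intro s hs
  rw [ContinuousWithinAt, tendsto_iff_norm_sub_tendsto_zero]
  have h1 : Tendsto (fun t : ℝ => |t - s|) (𝓝[Ici 0] s) (𝓝[≥] 0) := by
    refine tendsto_nhdsWithin_iff.2 ⟨?_, Eventually.of_forall fun t => mem_Ici.2 (abs_nonneg _)⟩
    have : Tendsto (fun t : ℝ => |t - s|) (𝓝 s) (𝓝 |s - s|) :=
      (continuous_abs.comp (continuous_id.sub continuous_const)).tendsto s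
    rw [sub_self, abs_zero] at this
    exact this.mono_left nhdsWithin_le_nhds
  have h2 := ((hS.semigroup.tendsto_zero' x).comp h1)
  have h3 : Tendsto (fun t => M * ‖S |t - s| x - x‖) (𝓝[Ici 0] s) (𝓝 0) := by
    have := ((h2.sub_const x).norm).const_mul M
    simpa using this
  refine squeeze_zero' (Eventually.of_forall fun _ => norm_nonneg _) ?_ h3
  filter_upwards [self_mem_nhdsWithin] with t ht
  exact hS.norm_apply_sub_le hs ht x

theorem continuous_max (hS : IsBoundedSemigroup S M) (x : X) :
    Continuous fun t => S (max t 0) x :=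
  (hS.continuousOn x).comp_continuous (continuous_id.max continuous_const) fun _ =>
    mem_Ici.2 (le_max_right _ _)

end IsBoundedSemigroup

variable {S : ℝ → X →L[ℂ] X} {M : ℝ} {A : X →ₗ.[ℂ] X}

theorem IsGenerator.tendsto (hA : IsGenerator S A) {x y : X} (h : (x, y) ∈ A.graph) :
    Tendsto (fun t : ℝ => ((t : ℂ)⁻¹) • (S t x - x)) (𝓝[>] 0) (𝓝 y) := (hA x y).1 h

theorem IsGenerator.apply_mem (hA : IsGenerator S A) (hS : IsBoundedSemigroup S M) {x y : X}
    (h : (x, y) ∈ A.graph) {t : ℝ} (ht : 0 ≤ t) : (S t x, S t y) ∈ A.graph := by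
  rw [hA]
  refine (((S t).continuous.tendsto y).comp (hA.tendsto h)).congr' ?_
  filter_upwards [self_mem_nhdsWithin] with s hs
  simp only [Function.comp, map_smul, map_sub]
  rw [hS.apply_comm ht (le_of_lt hs)]

/-- On the domain of the generator the orbit maps are differentiable. -/
theorem IsGenerator.hasDerivAt (hA : IsGenerator S A) (hS : IsBoundedSemigroup S M) {x y : X}
    (h : (x, y) ∈ A.graph) {t : ℝ} (ht : 0 < t) : HasDerivAt (fun s => S s x) (S t y) t := by
  have hre : ∀ (s : ℝ) (v : X), ((s : ℂ)⁻¹) • v = s⁻¹ • v := fun s v => by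
    rw [← Complex.ofReal_inv, Complex.coe_smul]
  rw [hasDerivAt_iff_tendsto_slope_left_right]
  constructor
  · rw [tendsto_iff_norm_sub_tendsto_zero]
    -- the left difference quotient is `S (t - h)` applied to the right one at `0`
    have hlim : Tendsto (fun s : ℝ => t - s) (𝓝[<] t) (𝓝[>] 0) := by
      refine tendsto_nhdsWithin_iff.2 ⟨?_, ?_⟩
      · have : Tendsto (fun s : ℝ => t - s) (𝓝 t) (𝓝 (t - t)) :=
          (continuous_const.sub continuous_id).tendsto t
        rw [sub_self] at this
        exact this.mono_left nhdsWithin_le_nhds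
      · filter_upwards [self_mem_nhdsWithin] with s hs
        simpa using hs
    have h1 := (((hA.tendsto h).comp hlim).sub_const y).norm.const_mul M
    have hc : Tendsto (fun s => S s y) (𝓝[<] t) (𝓝 (S t y)) := by
      have := ((hS.continuousOn y) t ht.le).mono (s := Icc 0 t) (fun s hs => hs.1)
      refine this.tendsto.mono_left ?_
      exact nhdsWithin_le_of_mem (mem_of_superset (Ioo_mem_nhdsLT ht) fun s hs => ⟨hs.1.le, hs.2.le⟩)
    have h2 := (hc.sub_const (S t y)).norm
    have h3 := h1.add h2
    simp only [sub_self, norm_zero, mul_zero, add_zero] at h3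
    refine squeeze_zero' (Eventually.of_forall fun _ => norm_nonneg _) ?_ h3
    filter_upwards [Ioo_mem_nhdsLT ht] with s hs
    have e1 : slope (fun s => S s x) t s - S t y
        = S s (((t - s : ℝ) : ℂ)⁻¹ • (S (t - s) x - x) - y) + (S s y - S t y) := by
      rw [map_sub, map_smul, map_sub, ← hS.apply_add hs.1.le (by linarith [hs.2]),
        add_sub_cancel, hre, slope_def_module, ← neg_sub t s, inv_neg, neg_smul, ← smul_neg, neg_sub]
      abel
    rw [e1]
    exact (norm_add_le _ _).trans (add_le_add_left (hS.norm_apply_le hs.1.le _) _)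
  · have hlim : Tendsto (fun s : ℝ => s - t) (𝓝[>] t) (𝓝[>] 0) := by
      refine tendsto_nhdsWithin_iff.2 ⟨?_, ?_⟩
      · have : Tendsto (fun s : ℝ => s - t) (𝓝 t) (𝓝 (t - t)) :=
          (continuous_id.sub continuous_const).tendsto t
        rw [sub_self] at this
        exact this.mono_left nhdsWithin_le_nhds
      · filter_upwards [self_mem_nhdsWithin] with s hs
        simpa using hs
    refine (((hA.tendsto (hA.apply_mem hS h ht.le))).comp hlim).congr' ?_
    filter_upwards [self_mem_nhdsWithin] with s hs
    simp only [Function.comp]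
    rw [hre, slope_def_module, ← hS.apply_add (by simpa using (le_of_lt hs)) ht.le, sub_add_cancel]

/-- Rescaling a bounded semigroup by `e^(-zt)`, `Re z ≥ 0`, gives a bounded semigroup. -/
theorem IsBoundedSemigroup.rescale (hS : IsBoundedSemigroup S M) {z : ℂ} (hz : 0 ≤ z.re) :
    IsBoundedSemigroup (fun t => Complex.exp (-(z * t)) • S t) M where
  semigroup :=
    { map_zero := by simp [hS.semigroup.map_zero]
      map_add := fun s t hs ht => by
        ext x
        simp only [smul_apply, ContinuousLinearMap.comp_apply, map_smul]
        rw [hS.apply_add hs ht, smul_smul, ← Complex.exp_add]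
        congr 2; push_cast; ring
      tendsto_zero := fun x => by
        have h1 : Tendsto (fun t : ℝ => Complex.exp (-(z * t))) (𝓝[>] 0) (𝓝 1) := by
          have : Continuous fun t : ℝ => Complex.exp (-(z * t)) := by fun_prop
          have h := this.tendsto 0
          simp only [Complex.ofReal_zero, mul_zero, neg_zero, Complex.exp_zero] at h
          exact h.mono_left nhdsWithin_le_nhds
        simpa using h1.smul (hS.semigroup.tendsto_zero x) }
  bound := fun t ht => by
    rw [norm_smul, Complex.norm_exp]
    have : Real.exp (-(z * t)).re ≤ 1 := by
      rw [Real.exp_le_one_iff]; simp; positivity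
    calc _ ≤ 1 * M := mul_le_mul this (hS.bound t ht) (norm_nonneg _) zero_le_one
      _ = M := one_mul M

theorem IsGenerator.rescale (hA : IsGenerator S A) (z : ℂ) :
    IsGenerator (fun t => Complex.exp (-(z * t)) • S t) (-(shift z A)) := by
  intro x y
  rw [mem_graph_neg_shift, hA]
  have hexp : Tendsto (fun t : ℝ => Complex.exp (-(z * t))) (𝓝[>] 0) (𝓝 1) := by
    have : Continuous fun t : ℝ => Complex.exp (-(z * t)) := by fun_prop
    have h := this.tendsto 0
    simp only [Complex.ofReal_zero, mul_zero, neg_zero, Complex.exp_zero] at h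
    exact h.mono_left nhdsWithin_le_nhds
  have hder : Tendsto (fun t : ℝ => (t : ℂ)⁻¹ * (Complex.exp (-(z * t)) - 1)) (𝓝[>] 0) (𝓝 (-z)) := by
    have h0 : HasDerivAt (fun t : ℝ => Complex.exp (-(z * t))) (-z) 0 := by
      have h1 : HasDerivAt (fun t : ℂ => Complex.exp (-(z * t))) (-z) ((0 : ℝ) : ℂ) := by
        have := ((hasDerivAt_id ((0 : ℝ) : ℂ)).const_mul z).neg.cexp
        simpa using this
      exact h1.comp_ofReal
    have := h0.tendsto_slope_zero_right
    simpa using this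
  have key : ∀ t : ℝ, (t : ℂ)⁻¹ • ((Complex.exp (-(z * t)) • S t) x - x)
      = Complex.exp (-(z * t)) • ((t : ℂ)⁻¹ • (S t x - x))
        + ((t : ℂ)⁻¹ * (Complex.exp (-(z * t)) - 1)) • x := by
    intro t
    simp only [smul_apply]
    module
  constructor
  · intro h
    have := (hexp.smul h).add (hder.smul_const x)
    rw [one_smul, neg_smul, add_neg_cancel_right] at this
    exact this.congr fun t => (key t).symm
  · intro h
    have hexp' := hexp.inv₀ one_ne_zero
    have := hexp'.smul (h.sub (hder.smul_const x))
    rw [inv_one, one_smul, neg_smul, sub_neg_eq_add] at this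
    refine this.congr fun t => ?_
    rw [key, add_sub_cancel_right, smul_smul, inv_mul_cancel₀ (Complex.exp_ne_zero _), one_smul]

end Semigroups

/-! ### Integrals of a bounded semigroup against scalar weights -/

section Transform

variable {X : Type*} [NormedAddCommGroup X] [NormedSpace ℂ X]
variable {S : ℝ → X →L[ℂ] X} {M : ℝ} {A : X →ₗ.[ℂ] X}

theorem IsBoundedSemigroup.integrableOn_smul (hS : IsBoundedSemigroup S M) {w : ℝ → ℂ}
    (hw : IntegrableOn w (Ioi 0)) (x : X) : IntegrableOn (fun t => w t • S t x) (Ioi 0) := by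
  have hmeas : AEStronglyMeasurable (fun t => S t x) (volume.restrict (Ioi 0)) :=
    ((hS.continuousOn x).mono Ioi_subset_Ici_self).aestronglyMeasurable measurableSet_Ioi
  refine Integrable.mono' (g := fun t => ‖w t‖ * (M * ‖x‖)) (hw.norm.mul_const _)
    (hw.aestronglyMeasurable.smul hmeas) ?_
  filter_upwards [ae_restrict_mem measurableSet_Ioi] with t ht
  rw [norm_smul]
  exact mul_le_mul_of_nonneg_left (hS.norm_apply_le (le_of_lt ht) x) (norm_nonneg _)

theorem IsBoundedSemigroup.norm_integral_smul_le (hS : IsBoundedSemigroup S M) {w : ℝ → ℂ}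
    (hw : IntegrableOn w (Ioi 0)) (x : X) :
    ‖∫ t in Ioi (0 : ℝ), w t • S t x‖ ≤ (M * ∫ t in Ioi (0 : ℝ), ‖w t‖) * ‖x‖ := by
  have : (M * ∫ t in Ioi (0 : ℝ), ‖w t‖) * ‖x‖ = ∫ t in Ioi (0 : ℝ), ‖w t‖ * (M * ‖x‖) := by
    rw [integral_mul_const]; ring
  rw [this]
  refine norm_integral_le_of_norm_le (hw.norm.mul_const _) ?_
  filter_upwards [ae_restrict_mem measurableSet_Ioi] with t ht
  rw [norm_smul]
  exact mul_le_mul_of_nonneg_left (hS.norm_apply_le (le_of_lt ht) x) (norm_nonneg _)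

/-- The bounded operator `x ↦ ∫₀^∞ w(t) S(t) x dt`, for an integrable weight `w` and a bounded
semigroup `S` (the Hille–Phillips functional calculus). -/
def IsBoundedSemigroup.transform (hS : IsBoundedSemigroup S M) {w : ℝ → ℂ}
    (hw : IntegrableOn w (Ioi 0)) : X →L[ℂ] X :=
  LinearMap.mkContinuous
    { toFun := fun x => ∫ t in Ioi (0 : ℝ), w t • S t x
      map_add' := fun x y => by
        simp only [map_add, smul_add]
        exact integral_add (hS.integrableOn_smul hw x) (hS.integrableOn_smul hw y)
      map_smul' := fun c x => by
        simp only [map_smul, RingHom.id_apply]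
        rw [← integral_smul]
        congr 1 with t
        rw [smul_comm] }
    (M * ∫ t in Ioi (0 : ℝ), ‖w t‖) (hS.norm_integral_smul_le hw)

namespace IsBoundedSemigroup

variable (hS : IsBoundedSemigroup S M) {w v : ℝ → ℂ} (hw : IntegrableOn w (Ioi 0))
  (hv : IntegrableOn v (Ioi 0))

theorem transform_apply (x : X) : hS.transform hw x = ∫ t in Ioi (0 : ℝ), w t • S t x := rfl

theorem norm_transform_le : ‖hS.transform hw‖ ≤ M * ∫ t in Ioi (0 : ℝ), ‖w t‖ :=
  LinearMap.mkContinuous_norm_le _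
    (mul_nonneg hS.nonneg (integral_nonneg fun _ => norm_nonneg _)) _

theorem transform_congr (h : ∀ t, 0 < t → w t = v t) : hS.transform hw = hS.transform hv := by
  ext x
  rw [transform_apply, transform_apply]
  exact setIntegral_congr_fun measurableSet_Ioi fun t ht => by simp only [h t ht]

variable [CompleteSpace X]

theorem commute_transform {Q : X →L[ℂ] X} (hQ : ∀ t, 0 ≤ t → Commute Q (S t)) :
    Commute Q (hS.transform hw) := by
  ext x
  rw [mul_apply_eq_comp, mul_apply_eq_comp, transform_apply, transform_apply,
    ← Q.integral_comp_comm (hS.integrableOn_smul hw x)]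
  refine setIntegral_congr_fun measurableSet_Ioi fun t ht => ?_
  have := congrArg (fun P : X →L[ℂ] X => P x) (hQ t (le_of_lt ht)).eq
  simp only [mul_apply_eq_comp] at this
  simp only [map_smul, this]

/-- Composition of two integrals against weights is the integral against the convolution. -/
theorem transform_transform_apply (x : X) :
    hS.transform hw (hS.transform hv x) =
      ∫ r in Ioi (0 : ℝ), (∫ s in 0..r, w s * v (r - s)) • S r x := by
  have hw' := (integrable_indicator_iff (measurableSet_Ioi (a := (0 : ℝ)))).2 hw
  have hv' := (integrable_indicator_iff (measurableSet_Ioi (a := (0 : ℝ)))).2 hv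
  set W := indicator (Ioi (0 : ℝ)) w
  set V := indicator (Ioi (0 : ℝ)) v
  set φ : ℝ → X := fun r => S (max r 0) x
  have hφ : Continuous φ := hS.continuous_max x
  have hφb : ∀ r, ‖φ r‖ ≤ M * ‖x‖ := fun r => hS.norm_apply_le (le_max_right _ _) x
  have hint : Integrable (fun p : ℝ × ℝ => (W p.2 * V (p.1 - p.2)) • φ p.1)
      (volume.prod volume) := by
    have h1 := hw'.convolution_integrand (ContinuousLinearMap.mul ℝ ℂ) hv'
    refine Integrable.mono' (h1.norm.mul_const (M * ‖x‖))
      (h1.aestronglyMeasurable.smul (hφ.comp continuous_fst).aestronglyMeasurable) ?_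
    refine Eventually.of_forall fun p => ?_
    rw [norm_smul]
    exact mul_le_mul_of_nonneg_left (hφb _) (norm_nonneg _)
  have hLHS : hS.transform hw (hS.transform hv x)
      = ∫ s, ∫ r, (W s * V (r - s)) • φ r := by
    rw [transform_apply, ← integral_indicator measurableSet_Ioi]
    congr 1 with s
    by_cases hs : s ∈ Ioi (0 : ℝ)
    · have hs0 : 0 < s := hs
      rw [indicator_of_mem hs]
      have e1 : S s (hS.transform hv x) = ∫ t in Ioi (0 : ℝ), v t • S (s + t) x := by
        rw [transform_apply, ← (S s).integral_comp_comm (hS.integrableOn_smul hv x)]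
        refine setIntegral_congr_fun measurableSet_Ioi fun t ht => ?_
        simp only [map_smul]
        rw [hS.apply_add hs0.le (le_of_lt ht)]
      have e2 : ∫ r, (W s * V (r - s)) • φ r = ∫ t, (W s * V t) • φ (t + s) := by
        rw [← integral_add_right_eq_self _ s]
        simp only [add_sub_cancel_right]
      rw [e1, e2, ← integral_smul, ← integral_indicator measurableSet_Ioi]
      congr 1 with t
      by_cases ht : t ∈ Ioi (0 : ℝ)
      · have ht0 : 0 < t := ht
        have : W s = w s := indicator_of_mem hs w
        have h2 : V t = v t := indicator_of_mem ht v
        rw [indicator_of_mem ht, this, h2, smul_smul]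
        simp only [φ]
        rw [max_eq_left (by linarith), add_comm]
      · have h2 : V t = 0 := indicator_of_notMem ht v
        rw [indicator_of_notMem ht, h2, mul_zero, zero_smul]
    · have : W s = 0 := indicator_of_notMem hs w
      rw [indicator_of_notMem hs]
      simp [this]
  have hconv := posConvolution_eq_convolution_indicator w v (ContinuousLinearMap.mul ℝ ℂ) volume
  rw [hLHS, integral_integral_swap (f := fun s r => (W s * V (r - s)) • φ r) hint.swap,
    ← integral_indicator measurableSet_Ioi]
  congr 1 with r
  rw [integral_smul_const]
  have h3 : ∫ s, W s * V (r - s) = posConvolution w v (ContinuousLinearMap.mul ℝ ℂ) volume r := by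
    rw [hconv]; rfl
  rw [h3, posConvolution]
  by_cases hr : r ∈ Ioi (0 : ℝ)
  · rw [indicator_of_mem hr, indicator_of_mem hr]
    simp only [φ, ContinuousLinearMap.mul_apply']
    rw [max_eq_left (le_of_lt hr)]
  · rw [indicator_of_notMem hr, indicator_of_notMem hr, zero_smul]

end IsBoundedSemigroup

end Transform

/-! ### The resolvent as a Laplace transform -/

section Laplace

variable {X : Type*} [NormedAddCommGroup X] [NormedSpace ℂ X]
variable {S : ℝ → X →L[ℂ] X} {M : ℝ} {A : X →ₗ.[ℂ] X}

theorem integrableOn_exp_neg_mul {z : ℂ} (hz : 0 < z.re) :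
    IntegrableOn (fun t : ℝ => Complex.exp (-(z * t))) (Ioi 0) := by
  have := integrableOn_exp_mul_complex_Ioi (a := -z) (by simpa using hz) 0
  simpa only [neg_mul] using this

theorem integral_norm_exp_neg_mul {z : ℂ} (hz : 0 < z.re) :
    ∫ t in Ioi (0 : ℝ), ‖Complex.exp (-(z * t))‖ = z.re⁻¹ := by
  have := integral_exp_mul_Ioi (a := -z.re) (by simpa using hz) 0
  simp only [mul_zero, Real.exp_zero, neg_div_neg_eq, one_div] at this
  rw [← this]
  congr 1 with t
  rw [Complex.norm_exp]
  simp

theorem setIntegral_comp_add_right_Ioi {E : Type*} [NormedAddCommGroup E] [NormedSpace ℝ E]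
    (f : ℝ → E) (a h : ℝ) : ∫ t in Ioi a, f (t + h) = ∫ t in Ioi (a + h), f t := by
  rw [← (measurePreserving_add_right volume h).setIntegral_preimage_emb
    (MeasurableEquiv.addRight h).measurableEmbedding f (Ioi (a + h))]
  simp

theorem IsGenerator.commute_isResolventAt (hA : IsGenerator S A) (hS : IsBoundedSemigroup S M)
    {z : ℂ} {R : X →L[ℂ] X} (hR : IsResolventAt A z R) {t : ℝ} (ht : 0 ≤ t) : Commute R (S t) := by
  ext x
  have h := hR.apply_sub (hA.apply_mem hS (hR.mem_graph x) ht)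
  rw [← map_smul, ← map_sub, sub_sub_cancel] at h
  exact h

variable [CompleteSpace X]

/-- The Laplace transform of a bounded semigroup is the resolvent of its generator. -/
theorem IsGenerator.isResolventAt (hA : IsGenerator S A) (hS : IsBoundedSemigroup S M) {z : ℂ}
    (hz : 0 < z.re) : IsResolventAt A z (hS.transform (integrableOn_exp_neg_mul hz)) := by
  set V : ℝ → X →L[ℂ] X := fun t => Complex.exp (-(z * t)) • S t with hVdef
  have hV : IsBoundedSemigroup V M := hS.rescale hz.le
  have hAV : IsGenerator V (-(shift z A)) := hA.rescale z
  set L := hS.transform (integrableOn_exp_neg_mul hz) with hL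
  have hLV : ∀ x, L x = ∫ t in Ioi (0 : ℝ), V t x := fun x => rfl
  have hVint : ∀ x, IntegrableOn (fun t => V t x) (Ioi 0) := fun x =>
    hS.integrableOn_smul (integrableOn_exp_neg_mul hz) x
  rw [isResolventAt_iff]
  refine ⟨fun x => ?_, fun u v huv => ?_⟩
  · have key : (L x, -x) ∈ (-(shift z A)).graph := by
      rw [hAV]
      have h1 : ∀ h : ℝ, 0 < h → V h (L x) - L x = -∫ t in 0..h, V (max t 0) x := by
        intro h hh
        have e1 : V h (L x) = ∫ t in Ioi h, V t x := by
          rw [hLV, ← (V h).integral_comp_comm (hVint x)]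
          have := setIntegral_comp_add_right_Ioi (fun t => V t x) 0 h
          rw [zero_add] at this
          rw [← this]
          refine setIntegral_congr_fun measurableSet_Ioi fun t ht => ?_
          rw [add_comm, hV.apply_add hh.le (le_of_lt ht)]
        have e2 := intervalIntegral.integral_interval_add_Ioi (hVint x)
          ((hVint x).mono_set (Ioi_subset_Ioi hh.le))
        have e3 : ∫ t in 0..h, V (max t 0) x = ∫ t in 0..h, V t x := by
          refine intervalIntegral.integral_congr fun t ht => ?_
          rw [uIcc_of_le hh.le] at ht
          simp only [max_eq_left ht.1]
        rw [e1, e3, hLV, ← e2]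
        abel
      have h2 : HasDerivAt (fun h : ℝ => ∫ t in 0..h, V (max t 0) x) x 0 := by
        have hc := hV.continuous_max x
        have := intervalIntegral.integral_hasDerivAt_right (hc.intervalIntegrable 0 0)
          (hc.stronglyMeasurableAtFilter _ _) hc.continuousAt
        simpa [hV.semigroup.map_zero] using this
      have h3 := h2.tendsto_slope_zero_right.neg
      refine h3.congr' ?_
      filter_upwards [self_mem_nhdsWithin] with h hh
      rw [h1 h hh, ← Complex.ofReal_inv, Complex.coe_smul]
      simp
    rw [mem_graph_neg_shift] at key
    rwa [neg_add_eq_sub] at key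
  · have huv' : (u, v - z • u) ∈ (-(shift z A)).graph := by
      rw [mem_graph_neg_shift]; simpa using huv
    have h1 := integral_Ioi_of_hasDerivAt_of_tendsto (f := fun t => V t u)
      (f' := fun t => V t (v - z • u)) (a := 0) (m := 0)
      ((hV.continuousOn u) 0 self_mem_Ici)
      (fun t ht => hAV.hasDerivAt hV huv' ht) (hVint _) ?_
    · rw [← hLV, hV.semigroup.map_zero] at h1
      rw [← neg_sub, map_neg, h1]
      simp
    · have hexp : Tendsto (fun t : ℝ => Real.exp (-(z.re * t)) * (M * ‖u‖)) atTop (𝓝 0) := by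
        have : Tendsto (fun t : ℝ => Real.exp (-(z.re * t))) atTop (𝓝 0) :=
          Real.tendsto_exp_neg_atTop_nhds_zero.comp (tendsto_id.const_mul_atTop hz)
        simpa using this.mul_const (M * ‖u‖)
      refine squeeze_zero_norm' ?_ hexp
      filter_upwards [eventually_ge_atTop 0] with t ht
      simp only [hVdef, smul_apply]
      rw [norm_smul, Complex.norm_exp]
      have : (-(z * t)).re = -(z.re * t) := by simp
      rw [this]
      exact mul_le_mul_of_nonneg_left (hS.norm_apply_le ht u) (Real.exp_nonneg _)

/-- The Hille–Yosida estimate. -/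
theorem IsGenerator.norm_le_of_isResolventAt (hA : IsGenerator S A) (hS : IsBoundedSemigroup S M)
    {z : ℂ} (hz : 0 < z.re) {R : X →L[ℂ] X} (hR : IsResolventAt A z R) : ‖R‖ ≤ M / z.re := by
  rw [hR.unique (hA.isResolventAt hS hz), div_eq_mul_inv, ← integral_norm_exp_neg_mul hz]
  exact hS.norm_transform_le _

/-- The Abelian limit `lim μ R(μ) x`, as `μ → 0` or `μ → ∞`, is the corresponding limit of the
rescaled orbit `S(t/μ) x`. -/
theorem IsBoundedSemigroup.tendsto_smul_transform (hS : IsBoundedSemigroup S M) {x y : X}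
    {l : Filter ℝ} [l.IsCountablyGenerated] (hl : ∀ᶠ μ in l, 0 < μ)
    (h : ∀ t, 0 < t → Tendsto (fun μ => S (t / μ) x) l (𝓝 y)) :
    Tendsto (fun μ : ℝ => (μ : ℂ) • ∫ t in Ioi (0 : ℝ), Complex.exp (-((μ : ℂ) * t)) • S t x)
      l (𝓝 y) := by
  have h1 : Tendsto (fun μ : ℝ => ∫ t in Ioi (0 : ℝ), Real.exp (-t) • S (t / μ) x) l
      (𝓝 (∫ t in Ioi (0 : ℝ), Real.exp (-t) • y)) := by
    refine tendsto_integral_filter_of_dominated_convergence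
      (fun t => Real.exp (-t) * (M * ‖x‖)) ?_ ?_ ?_ ?_
    · filter_upwards [hl] with μ hμ
      have hexp : ContinuousOn (fun t : ℝ => Real.exp (-t)) (Ioi 0) := by fun_prop
      refine (hexp.smul ?_).aestronglyMeasurable measurableSet_Ioi
      refine (hS.continuousOn x).comp (by fun_prop) fun t ht => ?_
      exact mem_Ici.2 (div_nonneg (le_of_lt ht) hμ.le)
    · filter_upwards [hl] with μ hμ
      filter_upwards [ae_restrict_mem measurableSet_Ioi] with t ht
      rw [norm_smul, Real.norm_eq_abs, Real.abs_exp]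
      exact mul_le_mul_of_nonneg_left (hS.norm_apply_le (div_nonneg (le_of_lt ht) hμ.le) x)
        (Real.exp_nonneg _)
    · exact (integrableOn_exp_neg_Ioi 0).mul_const _
    · filter_upwards [ae_restrict_mem measurableSet_Ioi] with t ht
      exact (h t ht).const_smul _
  rw [integral_smul_const, integral_exp_neg_Ioi_zero, one_smul] at h1
  refine h1.congr' ?_
  filter_upwards [hl] with μ hμ
  have h2 := integral_comp_mul_left_Ioi (fun t => Real.exp (-t) • S (t / μ) x) 0 hμ
  rw [mul_zero] at h2
  have h3 : ∫ t in Ioi (0 : ℝ), Real.exp (-t) • S (t / μ) x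
      = μ • ∫ t in Ioi (0 : ℝ), Real.exp (-(μ * t)) • S (μ * t / μ) x := by
    rw [h2, smul_smul, mul_inv_cancel₀ hμ.ne', one_smul]
  rw [h3, ← Complex.coe_smul]
  congr 1
  refine setIntegral_congr_fun measurableSet_Ioi fun t ht => ?_
  rw [mul_div_cancel_left₀ _ hμ.ne', ← Complex.coe_smul]
  push_cast
  rfl

theorem IsGenerator.dense_domain (hA : IsGenerator S A) (hS : IsBoundedSemigroup S M) :
    Dense (A.domain : Set X) := by
  intro x
  have h := hS.tendsto_smul_transform (x := x) (y := x) (l := atTop) (eventually_gt_atTop 0)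
    fun t ht => by
      refine (hS.semigroup.tendsto_zero x).comp (tendsto_nhdsWithin_iff.2 ⟨?_, ?_⟩)
      · exact tendsto_const_nhds.div_atTop tendsto_id
      · filter_upwards [eventually_gt_atTop 0] with μ hμ using div_pos ht hμ
  refine mem_closure_of_tendsto h ?_
  filter_upwards [eventually_gt_atTop 0] with μ hμ
  have := (hA.isResolventAt hS (z := μ) (by simpa using hμ)).mem_graph x
  exact A.domain.smul_mem _ (LinearPMap.mem_domain_of_mem_graph this)

end Laplace

/-! ### Uniqueness and duality of semigroups -/

section Uniqueness

variable {X : Type*} [NormedAddCommGroup X] [NormedSpace ℂ X]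
variable {S S' : ℝ → X →L[ℂ] X} {M M' : ℝ} {A : X →ₗ.[ℂ] X}

/-- A product rule for `s ↦ V(s) u(s)`, where `V` is only strongly continuous and locally bounded. -/
theorem hasDerivAt_clm_apply_of_strong {V : ℝ → X →L[ℂ] X} {u : ℝ → X} {s : ℝ} {u' v' : X}
    (hb : ∀ᶠ r in 𝓝 s, ‖V r‖ ≤ M) (hu : HasDerivAt u u' s)
    (hV : HasDerivAt (fun r => V r (u s)) v' s)
    (hc : ContinuousAt (fun r => V r u') s) :
    HasDerivAt (fun r => V r (u r)) (v' + V s u') s := by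
  rw [hasDerivAt_iff_tendsto_slope] at hu hV ⊢
  have h1 : Tendsto (fun r => V r (slope u s r - u')) (𝓝[≠] s) (𝓝 0) := by
    have h2 := (hu.sub_const u').norm.const_mul M
    simp only [sub_self, norm_zero, mul_zero] at h2
    refine squeeze_zero_norm' ?_ h2
    filter_upwards [hb.filter_mono nhdsWithin_le_nhds] with r hr
    exact (V r).le_of_opNorm_le hr _
  have h3 := (hV.add (hc.tendsto.mono_left nhdsWithin_le_nhds)).add h1
  rw [add_zero] at h3
  refine h3.congr fun r => ?_
  have hsm : ∀ v : X, V r ((r - s)⁻¹ • v) = (r - s)⁻¹ • V r v := fun v => by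
    rw [← Complex.coe_smul, map_smul, Complex.coe_smul]
  simp only [slope_def_module, map_sub, hsm]
  simp only [smul_sub]
  abel

variable [CompleteSpace X]

theorem eq_of_hasDerivAt_zero {E : Type*} [NormedAddCommGroup E] [NormedSpace ℝ E] [CompleteSpace E]
    {f : ℝ → E} {a b : ℝ} (hab : a ≤ b)
    (hc : ContinuousOn f (Icc a b)) (hd : ∀ s ∈ Ioo a b, HasDerivAt f 0 s) : f b = f a := by
  have := intervalIntegral.integral_eq_sub_of_hasDerivAt_of_le hab hc hd (by simp)
  simpa [sub_eq_zero, eq_comm] using this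

/-- A bounded semigroup is determined by its generator. -/
theorem IsGenerator.unique (hA : IsGenerator S A) (hS : IsBoundedSemigroup S M)
    (hA' : IsGenerator S' A) (hS' : IsBoundedSemigroup S' M') {t : ℝ} (ht : 0 ≤ t) :
    S t = S' t := by
  have hcore : ∀ x ∈ A.domain, S t x = S' t x := by
    intro x hx
    obtain ⟨y, hxy⟩ := LinearPMap.mem_domain_iff.1 hx
    -- `s ↦ S(t - s) S'(s) x` is constant on `[0, t]`
    have hcont : ContinuousOn (fun s => S (t - s) (S' s x)) (Icc 0 t) := by
      intro s hs
      rw [ContinuousWithinAt, tendsto_iff_norm_sub_tendsto_zero]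
      have h1 : Tendsto (fun r => S' r x) (𝓝[Icc 0 t] s) (𝓝 (S' s x)) :=
        ((hS'.continuousOn x) s hs.1).mono Icc_subset_Ici_self
      have h2 : Tendsto (fun r => S (t - r) (S' s x)) (𝓝[Icc 0 t] s) (𝓝 (S (t - s) (S' s x))) := by
        have : ContinuousOn (fun r => S (t - r) (S' s x)) (Icc 0 t) :=
          (hS.continuousOn (S' s x)).comp (by fun_prop) fun r hr => mem_Ici.2 (sub_nonneg.2 hr.2)
        exact this s hs
      have h3 := ((h1.sub_const (S' s x)).norm.const_mul M).add
        (h2.sub_const (S (t - s) (S' s x))).norm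
      simp only [sub_self, norm_zero, mul_zero, add_zero] at h3
      refine squeeze_zero' (Eventually.of_forall fun _ => norm_nonneg _) ?_ h3
      filter_upwards [self_mem_nhdsWithin] with r hr
      have : S (t - r) (S' r x) - S (t - s) (S' s x) = S (t - r) (S' r x - S' s x)
          + (S (t - r) (S' s x) - S (t - s) (S' s x)) := by rw [map_sub]; abel
      rw [this]
      exact (norm_add_le _ _).trans
        (add_le_add_left (hS.norm_apply_le (sub_nonneg.2 hr.2) _) _)
    have hderiv : ∀ s ∈ Ioo 0 t, HasDerivAt (fun s => S (t - s) (S' s x)) 0 s := by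
      intro s hs
      have hts : 0 < t - s := sub_pos.2 hs.2
      have hmem := hA'.apply_mem hS' hxy hs.1.le
      have h1 := hA'.hasDerivAt hS' hxy hs.1
      have h2 : HasDerivAt (fun r => S (t - r) (S' s x)) (-S (t - s) (S' s y)) s := by
        have := (hA.hasDerivAt hS hmem hts).scomp s ((hasDerivAt_id s).const_sub t)
        rw [neg_one_smul] at this
        exact this
      have h3 := hasDerivAt_clm_apply_of_strong (V := fun r => S (t - r)) (M := M) ?_ h1 h2 ?_
      · simpa using h3
      · filter_upwards [Iio_mem_nhds hs.2] with r hr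
        exact hS.bound _ (sub_nonneg.2 (le_of_lt hr))
      · refine ContinuousAt.comp (f := fun r => t - r) (g := fun r => S r (S' s y)) ?_ (by fun_prop)
        exact ((hS.continuousOn _).continuousAt (Ici_mem_nhds hts))
    have := eq_of_hasDerivAt_zero ht hcont hderiv
    simp only [sub_self, sub_zero, hS.semigroup.map_zero, hS'.semigroup.map_zero,
      one_apply_eq_self] at this
    exact this.symm
  refine ContinuousLinearMap.ext fun x => ?_
  exact congrFun (Continuous.ext_on (hA.dense_domain hS) (S t).continuous (S' t).continuous
    fun x hx => hcore x hx) x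

end Uniqueness

section Duality

variable {X : Type*} [NormedAddCommGroup X] [InnerProductSpace ℂ X] [CompleteSpace X]
variable {S S' : ℝ → X →L[ℂ] X} {M M' : ℝ} {A A' : X →ₗ.[ℂ] X}

/-- If the generators of two bounded semigroups are formally adjoint to each other, then the
semigroups are adjoint to each other: `s ↦ ⟪S(t - s) x, S'(s) y⟫` is constant for `x`, `y` in the
domains, which are dense. -/
theorem IsGenerator.eq_adjoint (hA : IsGenerator S A) (hS : IsBoundedSemigroup S M)
    (hA' : IsGenerator S' A') (hS' : IsBoundedSemigroup S' M')
    (hadj : ∀ x y x' y', (x, y) ∈ A.graph → (x', y') ∈ A'.graph → inner ℂ y x' = inner ℂ x y')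
    {t : ℝ} (ht : 0 ≤ t) : S' t = (S t).adjoint := by
  have hcore : ∀ x ∈ A.domain, ∀ x' ∈ A'.domain, inner ℂ x (S' t x') = inner ℂ (S t x) x' := by
    intro x hx x' hx'
    obtain ⟨y, hxy⟩ := LinearPMap.mem_domain_iff.1 hx
    obtain ⟨y', hxy'⟩ := LinearPMap.mem_domain_iff.1 hx'
    have hcont : ContinuousOn (fun s => inner ℂ (S (t - s) x) (S' s x')) (Icc 0 t) := by
      have h1 : ContinuousOn (fun s => S (t - s) x) (Icc 0 t) :=
        (hS.continuousOn x).comp (by fun_prop) fun r hr => mem_Ici.2 (sub_nonneg.2 hr.2)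
      exact h1.inner ((hS'.continuousOn x').mono Icc_subset_Ici_self)
    have hderiv : ∀ s ∈ Ioo 0 t,
        HasDerivAt (fun s => inner ℂ (S (t - s) x) (S' s x')) 0 s := by
      intro s hs
      have hts : 0 < t - s := sub_pos.2 hs.2
      have h1 := hA'.hasDerivAt hS' hxy' hs.1
      have h2 : HasDerivAt (fun r => S (t - r) x) (-S (t - s) y) s := by
        have := (hA.hasDerivAt hS hxy hts).scomp s ((hasDerivAt_id s).const_sub t)
        rw [neg_one_smul] at this
        exact this
      have h3 := h2.inner ℂ h1
      rw [inner_neg_left, hadj _ _ _ _ (hA.apply_mem hS hxy hts.le) (hA'.apply_mem hS' hxy' hs.1.le),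
        add_neg_cancel] at h3
      exact h3
    have := eq_of_hasDerivAt_zero ht hcont hderiv
    simpa [hS.semigroup.map_zero, hS'.semigroup.map_zero] using this
  have h2 : ∀ x' ∈ A'.domain, ∀ x, inner ℂ x (S' t x') = inner ℂ (S t x) x' := by
    intro x' hx' x
    exact congrFun (Continuous.ext_on (f := fun x => inner ℂ x (S' t x'))
      (g := fun x => inner ℂ (S t x) x') (hA.dense_domain hS) (by fun_prop) (by fun_prop)
      fun x hx => hcore x hx x' hx') x
  refine ContinuousLinearMap.ext fun x' => ?_
  refine congrFun (Continuous.ext_on (hA'.dense_domain hS') (S' t).continuous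
    ((S t).adjoint).continuous fun x' hx' => ?_) x'
  refine ext_inner_left ℂ fun x => ?_
  rw [h2 x' hx' x, ContinuousLinearMap.adjoint_inner_right]

end Duality

/-! ### Negative fractional powers -/

section FractionalPowers

variable {X : Type*} [NormedAddCommGroup X] [NormedSpace ℂ X]
variable {S : ℝ → X →L[ℂ] X} {M : ℝ} {A : X →ₗ.[ℂ] X}

theorem integrableOn_rpow_mul_exp_neg_mul {ε a : ℝ} (hε : 0 < ε) (ha : 0 < a) :
    IntegrableOn (fun t : ℝ => t ^ (a - 1) * Real.exp (-(ε * t))) (Ioi 0) := by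
  have := integrableOn_rpow_mul_exp_neg_mul_rpow (s := a - 1) (by linarith) zero_lt_one hε
  simpa [neg_mul] using this

/-- The weight `t ^ (a - 1) e ^ (-ε t) / Γ(a)`, whose integral against `S` is `(ε + G)^(-a)`. -/
def gammaWeight (ε a t : ℝ) : ℂ :=
  (((Real.Gamma a)⁻¹ * (t ^ (a - 1) * Real.exp (-(ε * t))) : ℝ) : ℂ)

theorem integrableOn_gammaWeight {ε a : ℝ} (hε : 0 < ε) (ha : 0 < a) :
    IntegrableOn (gammaWeight ε a) (Ioi 0) :=
  ((integrableOn_rpow_mul_exp_neg_mul hε ha).const_mul _).ofReal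

theorem integral_rpow_mul_sub_rpow {a b r : ℝ} (ha : 0 < a) (hb : 0 < b) (hr : 0 < r) :
    ∫ s in 0..r, s ^ (a - 1) * (r - s) ^ (b - 1) =
      r ^ (a + b - 1) * (Real.Gamma a * Real.Gamma b / Real.Gamma (a + b)) := by
  have h1 := Complex.betaIntegral_scaled a b hr
  have h2 := Complex.Gamma_mul_Gamma_eq_betaIntegral (s := a) (t := b) (by simpa) (by simpa)
  have h3 : Complex.Gamma (a + b) ≠ 0 :=
    Complex.Gamma_ne_zero_of_re_pos (by simp; linarith)
  have h4 : Complex.betaIntegral a b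
      = Complex.Gamma a * Complex.Gamma b / Complex.Gamma (a + b) := by
    rw [h2]; field_simp
  rw [h4] at h1
  apply Complex.ofReal_injective
  rw [← intervalIntegral.integral_ofReal]
  rw [show (((r ^ (a + b - 1) * (Real.Gamma a * Real.Gamma b / Real.Gamma (a + b)) : ℝ)) : ℂ)
    = (r : ℂ) ^ ((a : ℂ) + b - 1)
      * (Complex.Gamma a * Complex.Gamma b / Complex.Gamma (a + b)) by
    push_cast [Complex.ofReal_cpow hr.le]
    rw [← Complex.ofReal_add, Complex.Gamma_ofReal, Complex.Gamma_ofReal, Complex.Gamma_ofReal], ← h1]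
  refine intervalIntegral.integral_congr fun s hs => ?_
  rw [uIcc_of_le hr.le] at hs
  push_cast [Complex.ofReal_cpow hs.1, Complex.ofReal_cpow (sub_nonneg.2 hs.2)]
  rfl

theorem integral_gammaWeight_mul {ε a b r : ℝ} (ha : 0 < a) (hb : 0 < b) (hr : 0 < r) :
    ∫ s in 0..r, gammaWeight ε a s * gammaWeight ε b (r - s) = gammaWeight ε (a + b) r := by
  have h1 : ∀ s, gammaWeight ε a s * gammaWeight ε b (r - s)
      = ((((Real.Gamma a)⁻¹ * (Real.Gamma b)⁻¹ * Real.exp (-(ε * r)) : ℝ)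
        * (s ^ (a - 1) * (r - s) ^ (b - 1)) : ℝ) : ℂ) := by
    intro s
    have : Real.exp (-(ε * r)) = Real.exp (-(ε * s)) * Real.exp (-(ε * (r - s))) := by
      rw [← Real.exp_add]; congr 1; ring
    rw [gammaWeight, gammaWeight, ← Complex.ofReal_mul, this]
    congr 1; ring
  simp only [h1]
  rw [intervalIntegral.integral_ofReal, intervalIntegral.integral_const_mul,
    integral_rpow_mul_sub_rpow ha hb hr, gammaWeight]
  congr 1
  have := (Real.Gamma_pos_of_pos ha).ne'
  have := (Real.Gamma_pos_of_pos hb).ne'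
  field_simp

/-- The bounded operator `(ε + G)^(-a)`, where `-G` generates the bounded semigroup `S`. -/
def IsBoundedSemigroup.negPow (hS : IsBoundedSemigroup S M) {ε a : ℝ} (hε : 0 < ε) (ha : 0 < a) :
    X →L[ℂ] X :=
  hS.transform (integrableOn_gammaWeight hε ha)

theorem IsBoundedSemigroup.negPow_apply (hS : IsBoundedSemigroup S M) {ε a : ℝ} (hε : 0 < ε)
    (ha : 0 < a) (x : X) : hS.negPow hε ha x = negPowShift S ε a x := by
  rw [negPow, transform_apply, negPowShift, ← integral_smul]
  congr 1 with t
  rw [gammaWeight, smul_smul, ← Complex.ofReal_mul]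

variable [CompleteSpace X]

theorem IsBoundedSemigroup.negPow_mul_negPow (hS : IsBoundedSemigroup S M) {ε a b c : ℝ}
    (hε : 0 < ε) (ha : 0 < a) (hb : 0 < b) (hc : 0 < c) (habc : a + b = c) :
    hS.negPow hε ha * hS.negPow hε hb = hS.negPow hε hc := by
  subst habc
  ext x
  rw [mul_apply_eq_comp, negPow, negPow, negPow, transform_transform_apply, transform_apply]
  refine setIntegral_congr_fun measurableSet_Ioi fun r hr => ?_
  simp only [integral_gammaWeight_mul ha hb hr]

theorem IsBoundedSemigroup.commute_negPow (hS : IsBoundedSemigroup S M) {ε a : ℝ}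
    (hε : 0 < ε) (ha : 0 < a) {Q : X →L[ℂ] X} (hQ : ∀ t, 0 ≤ t → Commute Q (S t)) :
    Commute Q (hS.negPow hε ha) :=
  hS.commute_transform _ hQ

theorem IsGenerator.isResolventAt_negPow_one (hA : IsGenerator S A) (hS : IsBoundedSemigroup S M)
    {ε : ℝ} (hε : 0 < ε) : IsResolventAt A ε (hS.negPow hε one_pos) := by
  have : hS.negPow hε one_pos
      = hS.transform (integrableOn_exp_neg_mul (z := ε) (by simpa using hε)) := by
    refine hS.transform_congr _ _ fun t ht => ?_
    simp [gammaWeight]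
  rw [this]
  exact hA.isResolventAt hS (by simpa using hε)

theorem IsBoundedSemigroup.negPow_natCast (hS : IsBoundedSemigroup S M) {ε : ℝ} (hε : 0 < ε)
    {n : ℕ} (hn : 0 < (n : ℝ)) : hS.negPow hε hn = hS.negPow hε one_pos ^ n := by
  have key : ∀ n : ℕ, ∀ h : 0 < ((n + 1 : ℕ) : ℝ),
      hS.negPow hε h = hS.negPow hε one_pos ^ (n + 1) := by
    intro n
    induction n with
    | zero => intro h; simp
    | succ n ih =>
      intro h
      rw [pow_succ, ← ih (by positivity)]
      exact (hS.negPow_mul_negPow hε _ _ _ (by push_cast; ring)).symm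
  obtain ⟨k, rfl⟩ := Nat.exists_eq_succ_of_ne_zero (n := n) (by rintro rfl; simp at hn)
  exact key k hn

/-- The decomposition behind the moment inequality. Splitting the integral for `(ε + G)^(-κ)`,
`0 < κ ≤ 1`, at `t = τ` and integrating the tail by parts gives `(ε + G)^(-κ) = U + (ε + G)⁻¹ W` with
`‖U‖ = O(τ ^ κ)` and `‖W‖ = O(τ ^ (κ - 1))`, uniformly in `ε`. -/
theorem IsGenerator.exists_negPow_eq_add (hA : IsGenerator S A) (hS : IsBoundedSemigroup S M)
    {ε κ τ : ℝ} (hε : 0 < ε) (hκ : 0 < κ) (hκ1 : κ ≤ 1) (hτ : 0 < τ) {E : X →L[ℂ] X}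
    (hE : IsResolventAt A ε E) :
    ∃ U W : X →L[ℂ] X, hS.negPow hε hκ = U + E * W ∧
      ‖U‖ ≤ M * ((Real.Gamma κ)⁻¹ * (τ ^ κ / κ)) ∧
      ‖W‖ ≤ M * ((Real.Gamma κ)⁻¹ * (2 * τ ^ (κ - 1))) := by
  have hg : 0 < (Real.Gamma κ)⁻¹ := inv_pos.2 (Real.Gamma_pos_of_pos hκ)
  set g := (Real.Gamma κ)⁻¹
  have hM := hS.nonneg
  have hexp1 : ∀ t : ℝ, 0 < t → Real.exp (-(ε * t)) ≤ 1 := fun t ht => by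
    rw [Real.exp_le_one_iff]; nlinarith
  set wU : ℝ → ℂ := indicator (Iic τ) (gammaWeight ε κ) with hwU
  set p : ℝ → ℝ := fun t => (κ - 1) * t ^ (κ - 2) * Real.exp (-(ε * t)) with hp
  set wW : ℝ → ℂ := indicator (Ioi τ) (fun t => (p t : ℂ)) with hwW
  have hUint : IntegrableOn wU (Ioi 0) := (integrableOn_gammaWeight hε hκ).indicator measurableSet_Iic
  have hpint : IntegrableOn p (Ioi τ) := by
    have h0 : IntegrableOn (fun t : ℝ => |κ - 1| * τ ^ (κ - 2) * Real.exp (-(ε * t))) (Ioi τ) := by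
      have := (exp_neg_integrableOn_Ioi τ hε).const_mul (|κ - 1| * τ ^ (κ - 2))
      simp only [neg_mul] at this
      exact this
    refine Integrable.mono' h0 ?_ ?_
    · refine ContinuousOn.aestronglyMeasurable ?_ measurableSet_Ioi
      refine (continuousOn_const.mul (ContinuousOn.rpow_const continuousOn_id ?_)).mul (by fun_prop)
      exact fun t ht => Or.inl (hτ.trans ht).ne'
    · filter_upwards [ae_restrict_mem measurableSet_Ioi] with t ht
      have ht0 : 0 < t := hτ.trans ht
      rw [Real.norm_eq_abs, abs_mul, abs_mul, Real.abs_exp, abs_of_nonneg (Real.rpow_nonneg ht0.le _)]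
      have hle := Real.rpow_le_rpow_of_nonpos (z := κ - 2) hτ (le_of_lt ht) (by linarith)
      gcongr
  have hpint0 : IntegrableOn wW (Ioi 0) := by
    rw [hwW, IntegrableOn, integrable_indicator_iff measurableSet_Ioi, IntegrableOn,
      Measure.restrict_restrict measurableSet_Ioi, inter_eq_left.2 (Ioi_subset_Ioi hτ.le)]
    exact Integrable.ofReal hpint
  have hpnorm : ∫ t in Ioi (0 : ℝ), ‖wW t‖ ≤ τ ^ (κ - 1) := by
    have e1 : ∫ t in Ioi (0 : ℝ), ‖wW t‖ = ∫ t in Ioi τ, |p t| := by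
      have : (fun t => ‖wW t‖) = indicator (Ioi τ) (fun t => |p t|) := by
        ext t
        rw [hwW, norm_indicator_eq_indicator_norm]
        simp
      rw [this, setIntegral_indicator measurableSet_Ioi, inter_eq_right.2 (Ioi_subset_Ioi hτ.le)]
    rw [e1]
    rcases eq_or_lt_of_le hκ1 with h1 | h1
    · have : ∀ t, p t = 0 := fun t => by simp [hp, h1]
      simp only [this, abs_zero, integral_zero]
      positivity
    · have e2 := integral_Ioi_rpow_of_lt (a := κ - 2) (by linarith) hτ
      have hi := integrableOn_Ioi_rpow_of_lt (a := κ - 2) (by linarith) hτ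
      calc ∫ t in Ioi τ, |p t| ≤ ∫ t in Ioi τ, (1 - κ) * t ^ (κ - 2) := by
            refine setIntegral_mono_on hpint.abs (hi.const_mul _) measurableSet_Ioi fun t ht => ?_
            have ht0 : 0 < t := hτ.trans ht
            rw [abs_mul, abs_mul, Real.abs_exp, abs_of_nonneg (Real.rpow_nonneg ht0.le _),
              abs_of_nonpos (by linarith : κ - 1 ≤ 0), neg_sub]
            exact mul_le_of_le_one_right
              (mul_nonneg (by linarith) (Real.rpow_nonneg ht0.le _)) (hexp1 t ht0)
        _ = τ ^ (κ - 1) := by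
            rw [integral_const_mul, e2, show κ - 2 + 1 = κ - 1 by ring]
            have : κ - 1 ≠ 0 := by linarith
            field_simp
            ring
        _ ≤ _ := le_rfl
  have hUnorm : ∫ t in Ioi (0 : ℝ), ‖wU t‖ ≤ g * (τ ^ κ / κ) := by
    have e1 : ∫ t in Ioi (0 : ℝ), ‖wU t‖ = ∫ t in Ioc 0 τ, ‖gammaWeight ε κ t‖ := by
      have : (fun t => ‖wU t‖) = indicator (Iic τ) (fun t => ‖gammaWeight ε κ t‖) := by
        ext t
        rw [hwU, norm_indicator_eq_indicator_norm]
      rw [this, setIntegral_indicator measurableSet_Iic, Ioi_inter_Iic]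
    have hi : IntegrableOn (fun t : ℝ => t ^ (κ - 1)) (Ioc 0 τ) := by
      rw [← intervalIntegrable_iff_integrableOn_Ioc_of_le hτ.le]
      exact intervalIntegral.intervalIntegrable_rpow' (by linarith)
    rw [e1]
    calc ∫ t in Ioc 0 τ, ‖gammaWeight ε κ t‖ ≤ ∫ t in Ioc 0 τ, g * t ^ (κ - 1) := by
          refine setIntegral_mono_on ((integrableOn_gammaWeight hε hκ).mono_set
            Ioc_subset_Ioi_self).norm (hi.const_mul _) measurableSet_Ioc fun t ht => ?_
          have h0 := Real.rpow_nonneg ht.1.le (κ - 1)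
          rw [gammaWeight, Complex.norm_real, Real.norm_eq_abs, abs_of_nonneg (by positivity)]
          exact mul_le_mul_of_nonneg_left (mul_le_of_le_one_right h0 (hexp1 t ht.1)) hg.le
      _ = g * (τ ^ κ / κ) := by
          rw [integral_const_mul, ← intervalIntegral.integral_of_le hτ.le,
            integral_rpow (Or.inl (by linarith))]
          simp [Real.zero_rpow hκ.ne']
  refine ⟨hS.transform hUint,
    ((g : ℝ) : ℂ) • (((τ ^ (κ - 1) * Real.exp (-(ε * τ)) : ℝ) : ℂ) • S τ + hS.transform hpint0),
    ?_, ?_, ?_⟩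
  · ext x
    have hmem := hE.mem_graph x
    set V : ℝ → X →L[ℂ] X := fun t => Complex.exp (-((ε : ℂ) * t)) • S t with hVdef
    have hV : IsBoundedSemigroup V M := hS.rescale (by simpa using hε.le)
    have hAV : IsGenerator V (-(shift ε A)) := hA.rescale ε
    have hmem' : (E x, -x) ∈ (-(shift ε A)).graph := by
      rw [mem_graph_neg_shift, neg_add_eq_sub]; exact hmem
    have hVS : ∀ (t : ℝ) (y : X), V t y = Real.exp (-(ε * t)) • S t y := fun t y => by
      rw [hVdef, ← Complex.coe_smul]; push_cast; rfl
    have hsplit : hS.negPow hε hκ x = hS.transform hUint x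
        + ∫ t in Ioi τ, (g * t ^ (κ - 1)) • V t x := by
      have e1 : hS.transform hUint x = ∫ t in Ioc 0 τ, gammaWeight ε κ t • S t x := by
        rw [hS.transform_apply]
        have : (fun t => wU t • S t x) = indicator (Iic τ) (fun t => gammaWeight ε κ t • S t x) := by
          ext t
          rw [hwU, indicator_smul_apply_left]
        rw [this, setIntegral_indicator measurableSet_Iic, Ioi_inter_Iic]
      have e2 : ∫ t in Ioi τ, (g * t ^ (κ - 1)) • V t x
          = ∫ t in Ioi τ, gammaWeight ε κ t • S t x := by
        congr 1 with t
        rw [hVS, gammaWeight, Complex.coe_smul, smul_smul, mul_assoc]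
      have hi := hS.integrableOn_smul (integrableOn_gammaWeight hε hκ) x
      rw [e1, e2, ← setIntegral_union (Ioc_disjoint_Ioi le_rfl) measurableSet_Ioi
        (hi.mono_set Ioc_subset_Ioi_self) (hi.mono_set (Ioi_subset_Ioi hτ.le)),
        Ioc_union_Ioi_eq_Ioi hτ.le]
      rfl
    have hparts : ∫ t in Ioi τ, (t ^ (κ - 1)) • V t x
        = τ ^ (κ - 1) • V τ (E x) + ∫ t in Ioi τ, ((κ - 1) * t ^ (κ - 2)) • V t (E x) := by
      have hi1 : IntegrableOn (fun t : ℝ => (t ^ (κ - 1)) • V t x) (Ioi τ) := by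
        have := (hS.integrableOn_smul (integrableOn_gammaWeight hε hκ) x).mono_set
          (Ioi_subset_Ioi hτ.le) |>.smul g⁻¹
        refine this.congr (Eventually.of_forall fun t => ?_)
        simp only [Pi.smul_apply]
        rw [hVS, gammaWeight, Complex.coe_smul, smul_smul, smul_smul, ← mul_assoc,
          inv_mul_cancel₀ hg.ne', one_mul]
      have hi2 : IntegrableOn (fun t : ℝ => ((κ - 1) * t ^ (κ - 2)) • V t (E x)) (Ioi τ) := by
        have := (hS.integrableOn_smul hpint0 (E x)).mono_set (Ioi_subset_Ioi hτ.le)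
        refine this.congr_fun (fun t ht => ?_) measurableSet_Ioi
        simp only
        rw [hwW, indicator_of_mem ht, hVS, Complex.coe_smul, smul_smul]
      have hd : ∀ t ∈ Ioi τ, HasDerivAt (fun t : ℝ => t ^ (κ - 1) • V t (E x))
          (((κ - 1) * t ^ (κ - 2)) • V t (E x) - t ^ (κ - 1) • V t x) t := by
        intro t ht
        have ht0 : 0 < t := hτ.trans ht
        have h1 := (Real.hasDerivAt_rpow_const (x := t) (p := κ - 1) (Or.inl ht0.ne')).smul
          (hAV.hasDerivAt hV hmem' ht0)
        refine h1.congr_deriv ?_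
        rw [map_neg, smul_neg, show κ - 1 - 1 = κ - 2 by ring]
        abel
      have hlim : Tendsto (fun t : ℝ => t ^ (κ - 1) • V t (E x)) atTop (𝓝 0) := by
        have h1 : Tendsto (fun t : ℝ => τ ^ (κ - 1) * (Real.exp (-(ε * t)) * (M * ‖E x‖))) atTop
            (𝓝 0) := by
          have : Tendsto (fun t : ℝ => Real.exp (-(ε * t))) atTop (𝓝 0) :=
            Real.tendsto_exp_neg_atTop_nhds_zero.comp (tendsto_id.const_mul_atTop hε)
          simpa using (this.mul_const (M * ‖E x‖)).const_mul (τ ^ (κ - 1))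
        refine squeeze_zero_norm' ?_ h1
        filter_upwards [eventually_gt_atTop τ] with t ht
        have ht0 : 0 < t := hτ.trans ht
        rw [norm_smul, hVS, norm_smul, Real.norm_eq_abs, Real.norm_eq_abs, Real.abs_exp,
          abs_of_nonneg (Real.rpow_nonneg ht0.le _)]
        have hle := Real.rpow_le_rpow_of_nonpos (z := κ - 1) hτ ht.le (by linarith)
        have hSt := hS.norm_apply_le ht0.le (E x)
        gcongr
      have hc : ContinuousWithinAt (fun t : ℝ => t ^ (κ - 1) • V t (E x)) (Ici τ) τ := by
        have h2 : ContinuousWithinAt (fun t : ℝ => t ^ (κ - 1)) (Ici τ) τ :=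
          (Real.continuousAt_rpow_const _ _ (Or.inl hτ.ne')).continuousWithinAt
        refine h2.smul ?_
        exact ((hV.continuousOn (E x)) τ hτ.le).mono (Ici_subset_Ici.2 hτ.le)
      have h1 := integral_Ioi_of_hasDerivAt_of_tendsto hc hd (hi2.sub hi1) hlim
      rw [integral_sub hi2 hi1, zero_sub] at h1
      rw [← sub_eq_iff_eq_add, ← neg_sub, h1, neg_neg]
    have hcomm : Commute E (S τ) := hA.commute_isResolventAt hS hE hτ.le
    have hcommT : Commute E (hS.transform hpint0) :=
      hS.commute_transform _ fun t ht => hA.commute_isResolventAt hS hE ht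
    have e3 : hS.transform hpint0 (E x) = ∫ t in Ioi τ, ((κ - 1) * t ^ (κ - 2)) • V t (E x) := by
      rw [hS.transform_apply]
      have : (fun t => wW t • S t (E x))
          = indicator (Ioi τ) (fun t => ((κ - 1) * t ^ (κ - 2)) • V t (E x)) := by
        ext t
        rw [hwW]
        by_cases ht : t ∈ Ioi τ
        · rw [indicator_of_mem ht, indicator_of_mem ht, hVS, Complex.coe_smul, smul_smul]
        · rw [indicator_of_notMem ht, indicator_of_notMem ht, zero_smul]
      rw [this, setIntegral_indicator measurableSet_Ioi, inter_eq_right.2 (Ioi_subset_Ioi hτ.le)]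
    rw [hsplit, add_apply, mul_apply_eq_comp]
    congr 1
    have e4 : ∫ t in Ioi τ, (g * t ^ (κ - 1)) • V t x = g • ∫ t in Ioi τ, (t ^ (κ - 1)) • V t x := by
      rw [← integral_smul]; congr 1 with t; rw [smul_smul]
    have c1 : E (S τ x) = S τ (E x) := congrArg (fun P : X →L[ℂ] X => P x) hcomm.eq
    have c2 : E (hS.transform hpint0 x) = hS.transform hpint0 (E x) :=
      congrArg (fun P : X →L[ℂ] X => P x) hcommT.eq
    have c3 : E ((((g : ℝ) : ℂ) • (((τ ^ (κ - 1) * Real.exp (-(ε * τ)) : ℝ) : ℂ) • S τ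
        + hS.transform hpint0)) x)
        = ((g : ℝ) : ℂ) • (((τ ^ (κ - 1) * Real.exp (-(ε * τ)) : ℝ) : ℂ) • E (S τ x)
        + E (hS.transform hpint0 x)) := by
      rw [smul_apply, map_smul, add_apply, map_add, smul_apply, map_smul]
    rw [c3, e4, hparts, ← e3, c1, c2, Complex.coe_smul, Complex.coe_smul, hVS, smul_smul]
  · exact (hS.norm_transform_le _).trans (mul_le_mul_of_nonneg_left hUnorm hM)
  · rw [norm_smul, Complex.norm_real, Real.norm_eq_abs, abs_of_pos hg]
    have h1 : ‖((τ ^ (κ - 1) * Real.exp (-(ε * τ)) : ℝ) : ℂ) • S τ‖ ≤ τ ^ (κ - 1) * M := by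
      rw [norm_smul, Complex.norm_real, Real.norm_eq_abs, abs_of_nonneg (by positivity)]
      exact mul_le_mul (mul_le_of_le_one_right (by positivity) (hexp1 τ hτ)) (hS.bound τ hτ.le)
        (norm_nonneg _) (by positivity)
    have h2 : ‖hS.transform hpint0‖ ≤ M * τ ^ (κ - 1) :=
      (hS.norm_transform_le _).trans (mul_le_mul_of_nonneg_left hpnorm hM)
    calc _ ≤ g * (τ ^ (κ - 1) * M + M * τ ^ (κ - 1)) := by
          gcongr
          exact (norm_add_le _ _).trans (add_le_add h1 h2)
      _ = _ := by ring

end FractionalPowers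

/-! ### The resolvent near a spectral point, multiplied by a fractional power -/

section CoreEstimate

variable {X : Type*} [NormedAddCommGroup X] [NormedSpace ℂ X]

theorem norm_pow_le_pow {a : X →L[ℂ] X} {r : ℝ} (h : ‖a‖ ≤ r) (n : ℕ) : ‖a ^ n‖ ≤ r ^ n := by
  induction n with
  | zero => rw [pow_zero, pow_zero]; exact ContinuousLinearMap.norm_id_le
  | succ n ih =>
    rw [pow_succ, pow_succ]
    exact (norm_mul_le _ _).trans
      (mul_le_mul ih h (norm_nonneg _) (pow_nonneg ((norm_nonneg _).trans h) n))

namespace IsResolventAt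

variable {A : X →ₗ.[ℂ] X} {z ε : ℂ} {R J E : X →L[ℂ] X}

theorem one_add_smul_mul (hJ : IsResolventAt A 1 J) (hE : IsResolventAt A ε E) :
    (1 + (ε - 1) • J) * E = J := by
  have h := hJ.sub_eq hE
  rw [add_mul, one_mul, smul_mul_assoc, ← h]
  abel

theorem mul_one_add_smul (hJ : IsResolventAt A 1 J) (hR : IsResolventAt A z R) :
    R * (1 + (ε - 1) • J) = ((ε - z) • J) * R + J := by
  have h := hR.sub_eq hJ
  have hc := (hR.commute hJ).eq
  have h2 : R = J + (1 - z) • (R * J) := by rw [← h]; abel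
  rw [mul_add, mul_one, mul_smul_comm, smul_mul_assoc, ← hc]
  nth_rewrite 1 [h2]
  module

theorem commute_one_add_smul (hJ : IsResolventAt A 1 J) (hR : IsResolventAt A z R) :
    Commute R (1 + (ε - 1) • J) :=
  (Commute.one_right R).add_right ((hR.commute hJ).smul_right _)

/-- With `H = 1 + (ε - 1) J` and `a = (ε - z) J` one has `R (H - a) = J`, hence a geometric sum. -/
theorem mul_one_add_smul_pow (hJ : IsResolventAt A 1 J) (hR : IsResolventAt A z R) (n : ℕ) :
    R * (1 + (ε - 1) • J) ^ n = ((ε - z) • J) ^ n * R +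
      J * ∑ i ∈ Finset.range n, (1 + (ε - 1) • J) ^ i * ((ε - z) • J) ^ (n - 1 - i) := by
  set H := 1 + (ε - 1) • J
  set a := (ε - z) • J
  have haR : Commute a R := ((hR.commute hJ).smul_right _).symm
  have haH : Commute H a :=
    ((Commute.one_left J).add_left ((Commute.refl J).smul_left _)).smul_right _
  have h1 : R * (H - a) = J := by
    rw [mul_sub, hJ.mul_one_add_smul hR, ← haR.eq]
    abel
  have h2 := haH.mul_geom_sum₂ n
  rw [← h1, mul_assoc, h2, mul_sub, (haR.pow_left n).eq]
  abel

end IsResolventAt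

variable [CompleteSpace X]

/-- If `‖R(μ)‖ ≤ M₁ |μ| ^ (-α)`, `α ≥ 1`, then `R(μ) (ε + G) ^ α (1 + G) ^ (-N)` is bounded uniformly in
`μ` and `ε ≤ |μ|`. Here `(ε + G) (1 + G)⁻¹ = 1 + (ε - 1) J` for `J = (1 + G)⁻¹`. -/
theorem exists_bound_resolvent_mul_negPow (M M₁ : ℝ) (hM₁ : 0 ≤ M₁) {α : ℝ} (hα : 1 ≤ α) {N : ℕ}
    (hN : 0 < N - α) :
    ∃ K : ℝ, 0 ≤ K ∧ ∀ (S : ℝ → X →L[ℂ] X) (A : X →ₗ.[ℂ] X) (hS : IsBoundedSemigroup S M),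
      IsGenerator S A → ∀ (μ : ℂ) (ε : ℝ) (hε : 0 < ε) (R J : X →L[ℂ] X), μ ≠ 0 → ‖μ‖ ≤ 1 →
      ε ≤ ‖μ‖ → IsResolventAt A μ R → ‖R‖ ≤ M₁ * ‖μ‖ ^ (-α) → IsResolventAt A 1 J →
      ‖R * (1 + ((ε : ℂ) - 1) • J) ^ N * hS.negPow hε hN‖ ≤ K := by
  -- it suffices to consider `N = ⌊α⌋ + 1`, for which the remaining power is `-κ` with `0 < κ ≤ 1`
  set n := ⌊α⌋₊ with hn
  have hn1 : 1 ≤ n := Nat.one_le_floor_iff _ |>.2 hα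
  have hnα : (n : ℝ) ≤ α := Nat.floor_le (by linarith)
  have hαn : α < n + 1 := Nat.lt_floor_add_one α
  set κ := (n : ℝ) + 1 - α with hκdef
  have hκ : 0 < κ := by linarith
  have hκ1 : κ ≤ 1 := by linarith
  have hnN : n + 1 ≤ N := by
    have : (n : ℝ) < N := by linarith
    exact_mod_cast this
  obtain ⟨l, rfl⟩ := Nat.exists_eq_add_of_le hnN
  have hg : 0 < (Real.Gamma κ)⁻¹ := inv_pos.2 (Real.Gamma_pos_of_pos hκ)
  -- no semigroup is bounded by a negative constant
  by_cases hM : 0 ≤ M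
  swap
  · exact ⟨0, le_rfl, fun S A hS => absurd hS.nonneg hM⟩
  set u := M * ((Real.Gamma κ)⁻¹ * κ⁻¹) with hu
  set w := M * ((Real.Gamma κ)⁻¹ * 2) with hw
  have hu0 : 0 ≤ u := by positivity
  have hw0 : 0 ≤ w := by positivity
  refine ⟨M ^ l * ((2 * M) ^ n * (2 * M * M₁ * u + M * u + M * M₁ * w) +
    M * (∑ i ∈ Finset.range n, (1 + M) ^ i * (2 * M) ^ (n - 1 - i)) * ((1 + M) * u + M * w)),
    by positivity, ?_⟩
  intro S A hS hA μ ε hε R J hμ hμ1 hεμ hR hRb hJ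
  have hE := hA.isResolventAt_negPow_one hS hε
  set E := hS.negPow hε one_pos
  set H := 1 + ((ε : ℂ) - 1) • J with hH
  set a := ((ε : ℂ) - μ) • J with ha
  set P := hS.negPow hε hκ
  set m := ‖μ‖ with hm
  have hm0 : 0 < m := norm_pos_iff.2 hμ
  have hHE : H * E = J := hJ.one_add_smul_mul hE
  have hJM : ‖J‖ ≤ M := by
    simpa using hA.norm_le_of_isResolventAt hS (z := 1) (by simp) hJ
  have hε1 : ε ≤ 1 := hεμ.trans hμ1
  have hHb : ‖H‖ ≤ 1 + M := by
    have h1 : ‖((ε : ℂ) - 1)‖ ≤ 1 := by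
      rw [← Complex.ofReal_one, ← Complex.ofReal_sub, Complex.norm_real, Real.norm_eq_abs,
        abs_le]
      constructor <;> linarith
    calc ‖H‖ ≤ ‖(1 : X →L[ℂ] X)‖ + ‖((ε : ℂ) - 1) • J‖ := norm_add_le _ _
      _ ≤ 1 + 1 * M := by
        gcongr
        · exact ContinuousLinearMap.norm_id_le
        · rw [norm_smul]; gcongr
      _ = 1 + M := by ring
  have hεμ' : ‖(ε : ℂ) - μ‖ ≤ 2 * m := by
    calc _ ≤ ‖(ε : ℂ)‖ + ‖μ‖ := norm_sub_le _ _
      _ ≤ m + m := by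
        gcongr
        rw [Complex.norm_real, Real.norm_eq_abs, abs_of_pos hε]
        exact hεμ
      _ = 2 * m := by ring
  have hab : ‖a‖ ≤ 2 * m * M := by
    rw [ha, norm_smul]; gcongr
  have hab' : ‖a‖ ≤ 2 * M := hab.trans (by nlinarith)
  -- the singular part, split at `τ = 1 / |μ|`
  have hT1 : ‖a ^ n * (R * H * P)‖ ≤ (2 * M) ^ n * (2 * M * M₁ * u + M * u + M * M₁ * w) := by
    obtain ⟨U, W, hP, hU, hW⟩ := hA.exists_negPow_eq_add hS hε hκ hκ1 (inv_pos.2 hm0) hE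
    have hU' : ‖U‖ ≤ u * m ^ (-κ) := by
      refine hU.trans_eq ?_
      rw [Real.inv_rpow hm0.le, ← Real.rpow_neg hm0.le, hu]; ring
    have hW' : ‖W‖ ≤ w * m ^ (1 - κ) := by
      refine hW.trans_eq ?_
      rw [Real.inv_rpow hm0.le, ← Real.rpow_neg hm0.le, hw, neg_sub]; ring
    have e1 : R * H * P = (a * R + J) * U + R * J * W := by
      rw [show P = U + E * W from hP, mul_add, hJ.mul_one_add_smul hR]
      congr 1
      rw [← hJ.mul_one_add_smul hR, mul_assoc R, ← mul_assoc H, hHE, ← mul_assoc]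
    have e2 : ‖R * H * P‖ ≤ (2 * m * M * (M₁ * m ^ (-α)) + M) * (u * m ^ (-κ))
        + M₁ * m ^ (-α) * M * (w * m ^ (1 - κ)) := by
      rw [e1]
      refine (norm_add_le _ _).trans (add_le_add ((norm_mul_le _ _).trans ?_)
        ((norm_mul_le _ _).trans ?_))
      · gcongr
        refine (norm_add_le _ _).trans (add_le_add ((norm_mul_le _ _).trans ?_) hJM)
        gcongr
      · gcongr
        refine (norm_mul_le _ _).trans ?_
        gcongr
    have p1 : m ^ n * (m * m ^ (-α) * m ^ (-κ)) = 1 := by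
      nth_rewrite 2 [← Real.rpow_one m]
      rw [← Real.rpow_natCast, ← Real.rpow_add hm0, ← Real.rpow_add hm0, ← Real.rpow_add hm0]
      rw [show (n : ℝ) + (1 + -α + -κ) = 0 by rw [hκdef]; ring, Real.rpow_zero]
    have p2 : m ^ n * m ^ (-κ) ≤ 1 := by
      rw [← Real.rpow_natCast, ← Real.rpow_add hm0]
      refine Real.rpow_le_one hm0.le hμ1 ?_
      have : (1 : ℝ) ≤ n := by exact_mod_cast hn1
      linarith
    have p3 : m ^ n * (m ^ (-α) * m ^ (1 - κ)) = 1 := by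
      rw [← Real.rpow_natCast, ← Real.rpow_add hm0, ← Real.rpow_add hm0]
      rw [show (n : ℝ) + (-α + (1 - κ)) = 0 by rw [hκdef]; ring, Real.rpow_zero]
    calc ‖a ^ n * (R * H * P)‖ ≤ (2 * m * M) ^ n * ((2 * m * M * (M₁ * m ^ (-α)) + M) *
          (u * m ^ (-κ)) + M₁ * m ^ (-α) * M * (w * m ^ (1 - κ))) := by
          refine (norm_mul_le _ _).trans ?_
          exact mul_le_mul (norm_pow_le_pow hab n) e2 (norm_nonneg _) (by positivity)
      _ = (2 * M) ^ n * (2 * M * M₁ * u * (m ^ n * (m * m ^ (-α) * m ^ (-κ)))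
          + M * u * (m ^ n * m ^ (-κ)) + M * M₁ * w * (m ^ n * (m ^ (-α) * m ^ (1 - κ)))) := by
          rw [mul_pow, mul_pow, mul_pow]; ring
      _ ≤ (2 * M) ^ n * (2 * M * M₁ * u * 1 + M * u * 1 + M * M₁ * w * 1) := by
          rw [p1, p3]; gcongr
      _ = _ := by ring
  -- the regular part, split at `τ = 1`
  have hT2 : ‖H * P‖ ≤ (1 + M) * u + M * w := by
    obtain ⟨U, W, hP, hU, hW⟩ := hA.exists_negPow_eq_add hS hε hκ hκ1 one_pos hE
    rw [Real.one_rpow, one_div] at hU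
    rw [Real.one_rpow, mul_one] at hW
    rw [show P = U + E * W from hP, mul_add, ← mul_assoc, hHE]
    refine (norm_add_le _ _).trans (add_le_add ((norm_mul_le _ _).trans ?_)
      ((norm_mul_le _ _).trans ?_))
    · gcongr
    · gcongr
  have hsum : ‖∑ i ∈ Finset.range n, H ^ i * a ^ (n - 1 - i)‖
      ≤ ∑ i ∈ Finset.range n, (1 + M) ^ i * (2 * M) ^ (n - 1 - i) := by
    refine norm_sum_le_of_le _ fun i _ => (norm_mul_le _ _).trans ?_
    exact mul_le_mul (norm_pow_le_pow hHb i) (norm_pow_le_pow hab' _) (norm_nonneg _) (by positivity)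
  have hmain : ‖R * H ^ (n + 1) * P‖ ≤
      (2 * M) ^ n * (2 * M * M₁ * u + M * u + M * M₁ * w) +
      M * (∑ i ∈ Finset.range n, (1 + M) ^ i * (2 * M) ^ (n - 1 - i)) * ((1 + M) * u + M * w) := by
    have e1 : R * H ^ (n + 1) * P = a ^ n * (R * H * P)
        + J * (∑ i ∈ Finset.range n, H ^ i * a ^ (n - 1 - i)) * (H * P) := by
      rw [pow_succ, ← mul_assoc, hJ.mul_one_add_smul_pow hR]
      simp only [add_mul, mul_assoc]
      rfl
    rw [e1]
    refine (norm_add_le _ _).trans (add_le_add hT1 ((norm_mul_le _ _).trans ?_))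
    refine mul_le_mul ((norm_mul_le _ _).trans ?_) hT2 (norm_nonneg _) (by positivity)
    exact mul_le_mul hJM hsum (norm_nonneg _) hM
  have hfac : hS.negPow hε hN = E ^ l * P := by
    rcases Nat.eq_zero_or_pos l with rfl | hl
    · simp only [pow_zero, one_mul, P]
      congr 1
      rw [hκdef]; push_cast; ring
    · have hl' : 0 < (l : ℝ) := by exact_mod_cast hl
      rw [← hS.negPow_natCast hε hl']
      exact (hS.negPow_mul_negPow hε hl' hκ hN (by rw [hκdef]; push_cast; ring)).symm
  have hHEc : Commute H E := (hJ.commute_one_add_smul hE).symm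
  have hJH : Commute J H := hJ.commute_one_add_smul hJ
  have e3 : R * H ^ (n + 1 + l) * hS.negPow hε hN = J ^ l * (R * H ^ (n + 1) * P) := by
    have c1 : Commute (R * H ^ (n + 1)) (J ^ l) :=
      (((hR.commute hJ).mul_left (hJH.symm.pow_left _))).pow_right l
    rw [hfac, pow_add, ← mul_assoc, ← mul_assoc, mul_assoc _ (H ^ l), ← hHEc.mul_pow, hHE, c1.eq,
      mul_assoc]
  rw [e3]
  exact (norm_mul_le _ _).trans
    (mul_le_mul (norm_pow_le_pow hJM l) hmain (norm_nonneg _) (by positivity))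

end CoreEstimate

/-! ### Regularizing sequences for fractional powers -/

section Regularization

variable {X : Type*} [NormedAddCommGroup X] [NormedSpace ℂ X] [CompleteSpace X]
variable {S : ℝ → X →L[ℂ] X} {M : ℝ} {G : X →ₗ.[ℂ] X}

/-- If `G ^ β d = b`, then `b` is the limit of vectors `z ε` with
`(ε + G) ^ (β - m) d = (ε + G) ^ (-m) (z ε)`. -/
theorem IsFracPow.exists_tendsto (hS : IsBoundedSemigroup S M) (hG : IsGenerator S (-G)) {β : ℝ}
    {d b : X} (h : IsFracPow G β d b) {m : ℕ} (hm : 0 < m - β) :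
    ∃ z : ℝ → X, (∀ (ε : ℝ) (hε : 0 < ε),
      hS.negPow hε hm d = (hS.negPow hε one_pos ^ m) (z ε)) ∧ Tendsto z (𝓝[>] 0) (𝓝 b) := by
  rcases h with ⟨rfl, rfl⟩ | ⟨hβ, S', hS'0, ⟨M', hM'⟩, hG', z, hz, hlim⟩
  · refine ⟨fun _ => d, fun ε hε => ?_, tendsto_const_nhds⟩
    have hm' : 0 < (m : ℝ) := by linarith
    rw [← hS.negPow_natCast hε hm']
    congr 2
    ring
  · refine ⟨z, fun ε hε => ?_, hlim⟩
    have hS' : IsBoundedSemigroup S' M' := ⟨hS'0, hM'⟩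
    have hm' : 0 < (m : ℝ) := by linarith
    have e1 : d = hS.negPow hε hβ (z ε) := by
      rw [hS.negPow_apply, ← hz ε hε, negPowShift, negPowShift]
      congr 1
      refine setIntegral_congr_fun measurableSet_Ioi fun t ht => ?_
      simp only [hG.unique hS hG' hS' (le_of_lt ht)]
    rw [e1, ← mul_apply_eq_comp, hS.negPow_mul_negPow hε hm hβ hm' (by ring),
      hS.negPow_natCast hε hm']

end Regularization

section RegularizationAdjoint

variable {X : Type*} [NormedAddCommGroup X] [InnerProductSpace ℂ X] [CompleteSpace X]
variable {S S' : ℝ → X →L[ℂ] X} {M M' : ℝ} {A G : X →ₗ.[ℂ] X}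

theorem IsBoundedSemigroup.negPow_eq_adjoint (hS : IsBoundedSemigroup S M)
    (hS' : IsBoundedSemigroup S' M') (h : ∀ t, 0 ≤ t → S' t = (S t).adjoint) {ε a : ℝ} (hε : 0 < ε)
    (ha : 0 < a) : hS'.negPow hε ha = (hS.negPow hε ha).adjoint := by
  have key : ∀ x y, inner ℂ x (hS'.negPow hε ha y) = inner ℂ (hS.negPow hε ha x) y := by
    intro x y
    have hw := integrableOn_gammaWeight hε ha
    rw [← inner_conj_symm (hS.negPow hε ha x) y]
    rw [negPow, negPow, transform_apply, transform_apply, ← integral_inner (hS'.integrableOn_smul hw y),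
      ← integral_inner (hS.integrableOn_smul hw x), ← integral_conj]
    refine setIntegral_congr_fun measurableSet_Ioi fun t ht => ?_
    simp only [h t (le_of_lt ht), inner_smul_right, map_mul, inner_conj_symm, gammaWeight,
      Complex.conj_ofReal, ContinuousLinearMap.adjoint_inner_right]
  refine ContinuousLinearMap.ext fun y => ext_inner_left ℂ fun x => ?_
  rw [key, ContinuousLinearMap.adjoint_inner_right]

/-- The counterpart of `IsFracPow.exists_tendsto` for an operator `G` such that `-G` is formally adjoint
to the generator of `S`. -/
theorem IsFracPow.exists_tendsto_adjoint (hS : IsBoundedSemigroup S M) (hA : IsGenerator S A)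
    (hadj : ∀ x y x' y', (x, y) ∈ A.graph → (x', y') ∈ (-G).graph → inner ℂ y x' = inner ℂ x y')
    {γ : ℝ} {e c : X} (h : IsFracPow G γ e c) {m : ℕ} (hm : 0 < m - γ) :
    ∃ w : ℝ → X, (∀ (ε : ℝ) (hε : 0 < ε),
      (hS.negPow hε hm).adjoint e = (hS.negPow hε one_pos ^ m).adjoint (w ε)) ∧
      Tendsto w (𝓝[>] 0) (𝓝 c) := by
  rcases h with ⟨rfl, rfl⟩ | ⟨hγ, S', hS'0, ⟨M', hM'⟩, hG', w, hw, hlim⟩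
  · refine ⟨fun _ => e, fun ε hε => ?_, tendsto_const_nhds⟩
    have hm' : 0 < (m : ℝ) := by linarith
    rw [← hS.negPow_natCast hε hm']
    congr 3
    ring
  · refine ⟨w, fun ε hε => ?_, hlim⟩
    have hS' : IsBoundedSemigroup S' M' := ⟨hS'0, hM'⟩
    have hm' : 0 < (m : ℝ) := by linarith
    have e1 : e = (hS.negPow hε hγ).adjoint (w ε) := by
      rw [← hS.negPow_eq_adjoint hS' (fun t ht => hA.eq_adjoint hS hG' hS' hadj ht), hS'.negPow_apply]
      exact (hw ε hε).symm
    rw [e1, ← ContinuousLinearMap.comp_apply, ← ContinuousLinearMap.adjoint_comp,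
      ← hS.negPow_natCast hε hm', ← hS.negPow_mul_negPow hε hγ hm hm' (by ring)]
    rfl

/-- The sesquilinear form of `R(μ)` between `b = G ^ β d` and `c = (G*) ^ γ e` is bounded uniformly in
`μ` if `‖R(μ)‖ ≤ M₁ |μ| ^ (-(β + γ))`. -/
theorem exists_bound_inner_resolvent (M M₁ : ℝ) (hM₁ : 0 ≤ M₁) {β γ : ℝ} (hα : 1 ≤ β + γ) :
    ∃ K : ℝ, 0 ≤ K ∧ ∀ (S : ℝ → X →L[ℂ] X) (G G' : X →ₗ.[ℂ] X), IsBoundedSemigroup S M →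
      IsGenerator S (-G) →
      (∀ x y x' y', (x, y) ∈ (-G).graph → (x', y') ∈ (-G').graph → inner ℂ y x' = inner ℂ x y') →
      ∀ (μ : ℂ) (R : X →L[ℂ] X), μ ≠ 0 → ‖μ‖ ≤ 1 → IsResolventAt (-G) μ R →
      ‖R‖ ≤ M₁ * ‖μ‖ ^ (-(β + γ)) →
      ∀ b d c e : X, IsFracPow G β d b → IsFracPow G' γ e c →
      ‖inner ℂ c (R b)‖ ≤ K * (‖b‖ * ‖c‖ + ‖d‖ * ‖e‖) := by
  set m := ⌊β⌋₊ + 1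
  set m' := ⌊γ⌋₊ + 1
  have hm : 0 < (m : ℝ) - β := sub_pos.2 (by simpa [m] using Nat.lt_floor_add_one β)
  have hm' : 0 < (m' : ℝ) - γ := sub_pos.2 (by simpa [m'] using Nat.lt_floor_add_one γ)
  set N := m' + m with hNdef
  have hN : 0 < (N : ℝ) - (β + γ) := by rw [hNdef]; push_cast; linarith
  obtain ⟨K, hK0, hK⟩ := exists_bound_resolvent_mul_negPow (X := X) M M₁ hM₁ hα hN
  -- no semigroup is bounded by a negative constant
  by_cases hM : 0 ≤ M
  swap
  · exact ⟨0, le_rfl, fun S G G' hS => absurd hS.nonneg hM⟩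
  set K₁ := M * ∑ i ∈ Finset.range N, (2 * M) ^ i with hK₁
  have hK₁0 : 0 ≤ K₁ := by positivity
  refine ⟨K₁ + 2 ^ N * K, by positivity, ?_⟩
  intro S G G' hS hG hadj μ R hμ hμ1 hR hRb b d c e hb hc
  obtain ⟨z, hz, hzlim⟩ := hb.exists_tendsto hS hG hm
  obtain ⟨w, hw, hwlim⟩ := hc.exists_tendsto_adjoint hS hG hadj hm'
  set J := hS.negPow one_pos one_pos
  have hJ : IsResolventAt (-G) 1 J := by simpa using hG.isResolventAt_negPow_one hS one_pos
  have hJM : ‖J‖ ≤ M := by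
    simpa using hG.norm_le_of_isResolventAt hS (z := 1) (by simp) hJ
  have hμ2 : ‖1 - μ‖ ≤ 2 := by
    calc ‖1 - μ‖ ≤ ‖(1 : ℂ)‖ + ‖μ‖ := norm_sub_le _ _
      _ ≤ 2 := by rw [norm_one]; linarith
  set x := (1 - μ) • J with hx
  have hxb : ‖x‖ ≤ 2 * M := by rw [hx, norm_smul]; gcongr
  -- the iterated resolvent identity
  have hexp : R = J * ∑ i ∈ Finset.range N, x ^ i + (1 - μ) ^ N • (R * J ^ N) := by
    have h1 : R * (1 - x) = J := by
      have := hR.sub_eq hJ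
      rw [mul_sub, mul_one, hx, mul_smul_comm, ← this]; abel
    have h2 := mul_neg_geom_sum x N
    have h3 : J * ∑ i ∈ Finset.range N, x ^ i = R - (1 - μ) ^ N • (R * J ^ N) := by
      rw [← mul_smul_comm, ← smul_pow, ← hx]
      nth_rewrite 1 [← h1]
      rw [mul_assoc, h2, mul_sub, mul_one]
    rw [h3, sub_add_cancel]
  have hfirst : ‖inner ℂ c ((J * ∑ i ∈ Finset.range N, x ^ i) b)‖ ≤ K₁ * (‖b‖ * ‖c‖) := by
    have h1 : ‖J * ∑ i ∈ Finset.range N, x ^ i‖ ≤ K₁ := by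
      refine (norm_mul_le _ _).trans (mul_le_mul hJM ?_ (norm_nonneg _) hM)
      exact norm_sum_le_of_le _ fun i _ => norm_pow_le_pow hxb i
    calc _ ≤ ‖c‖ * ‖(J * ∑ i ∈ Finset.range N, x ^ i) b‖ := norm_inner_le_norm _ _
      _ ≤ ‖c‖ * (K₁ * ‖b‖) := by gcongr; exact ContinuousLinearMap.le_of_opNorm_le _ h1 b
      _ = _ := by ring
  have hSJ : ∀ t, 0 ≤ t → Commute J (S t) := fun t ht => hG.commute_isResolventAt hS hJ ht
  have hSR : ∀ t, 0 ≤ t → Commute R (S t) := fun t ht => hG.commute_isResolventAt hS hR ht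
  have hsecond : ‖inner ℂ c ((R * J ^ N) b)‖ ≤ K * (‖d‖ * ‖e‖) := by
    have hlim : Tendsto (fun ε => ‖inner ℂ (w ε) ((R * J ^ N) (z ε))‖) (𝓝[>] 0)
        (𝓝 ‖inner ℂ c ((R * J ^ N) b)‖) :=
      (hwlim.inner (((R * J ^ N).continuous.tendsto b).comp hzlim)).norm
    refine le_of_tendsto hlim ?_
    filter_upwards [Ioc_mem_nhdsGT (norm_pos_iff.2 hμ)] with ε hε
    have hε0 : 0 < ε := hε.1
    set E := hS.negPow hε0 one_pos
    have hE : IsResolventAt (-G) ε E := hG.isResolventAt_negPow_one hS hε0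
    set H := 1 + ((ε : ℂ) - 1) • J
    have hHE : H * E = J := hJ.one_add_smul_mul hE
    have hEH : Commute E H := hJ.commute_one_add_smul hE
    have hRH : ∀ t, 0 ≤ t → Commute (R * H ^ N) (S t) := fun t ht =>
      (hSR t ht).mul_left (((Commute.one_left _).add_left ((hSJ t ht).smul_left _)).pow_left N)
    have e1 : R * J ^ N = E ^ m' * (R * H ^ N) * E ^ m := by
      have c1 : Commute (E ^ m') (R * H ^ N) :=
        ((hE.commute hR).mul_right (hEH.pow_right N)).pow_left m'
      rw [← hHE, hEH.symm.mul_pow, c1.eq, hNdef, pow_add E, ← mul_assoc, ← mul_assoc]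
    have e2 : inner ℂ (w ε) ((R * J ^ N) (z ε))
        = inner ℂ e ((R * H ^ N * hS.negPow hε0 hN) d) := by
      have c2 : Commute (R * H ^ N) (hS.negPow hε0 hm') := hS.commute_negPow hε0 hm' hRH
      calc inner ℂ (w ε) ((R * J ^ N) (z ε))
          = inner ℂ (w ε) ((E ^ m') ((R * H ^ N) ((E ^ m) (z ε)))) := by rw [e1]; rfl
        _ = inner ℂ ((E ^ m').adjoint (w ε)) ((R * H ^ N) (hS.negPow hε0 hm d)) := by
          rw [ContinuousLinearMap.adjoint_inner_left, hz ε hε0]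
        _ = inner ℂ e ((hS.negPow hε0 hm' * (R * H ^ N) * hS.negPow hε0 hm) d) := by
          rw [← hw ε hε0, ContinuousLinearMap.adjoint_inner_left]; rfl
        _ = _ := by
          rw [← c2.eq, mul_assoc, hS.negPow_mul_negPow hε0 hm' hm hN (by rw [hNdef]; push_cast; ring)]
    rw [e2]
    calc _ ≤ ‖e‖ * ‖(R * H ^ N * hS.negPow hε0 hN) d‖ := norm_inner_le_norm _ _
      _ ≤ ‖e‖ * (K * ‖d‖) := by
        gcongr
        exact ContinuousLinearMap.le_of_opNorm_le _
          (hK S (-G) hS hG μ ε hε0 R J hμ hμ1 hε.2 hR hRb hJ) d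
      _ = _ := by ring
  have hsplit : inner ℂ c (R b) = inner ℂ c ((J * ∑ i ∈ Finset.range N, x ^ i) b)
      + (1 - μ) ^ N * inner ℂ c ((R * J ^ N) b) := by
    conv_lhs => rw [hexp]
    rw [add_apply, smul_apply, inner_add_right, inner_smul_right]
  rw [hsplit]
  have hpow : ‖(1 - μ) ^ N‖ ≤ 2 ^ N := by rw [norm_pow]; gcongr
  calc _ ≤ K₁ * (‖b‖ * ‖c‖) + 2 ^ N * (K * (‖d‖ * ‖e‖)) := by
        refine (norm_add_le _ _).trans (add_le_add hfirst ?_)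
        rw [norm_mul]
        gcongr
    _ ≤ (K₁ + 2 ^ N * K) * (‖b‖ * ‖c‖ + ‖d‖ * ‖e‖) := by
        have h1 : 0 ≤ K₁ * (‖d‖ * ‖e‖) := by positivity
        have h2 : 0 ≤ 2 ^ N * K * (‖b‖ * ‖c‖) := by positivity
        nlinarith

end RegularizationAdjoint

/-! ### Resolvent bounds in the closed right half-plane -/

section HalfPlane

variable {X : Type*} [NormedAddCommGroup X] [NormedSpace ℂ X] [CompleteSpace X]
variable {T : ℝ → X →L[ℂ] X} {M₀ : ℝ} {A : X →ₗ.[ℂ] X}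

theorem mem_resolventSet_of_spectrum_eq (hT : IsBoundedSemigroup T M₀) (hA : IsGenerator T A)
    {Z : Set ℂ} (hspec : spectrum A ∩ {z : ℂ | z.re = 0} = Z) {z : ℂ} (hz : 0 ≤ z.re)
    (hzZ : z ∉ Z) : z ∈ resolventSet A := by
  rcases eq_or_lt_of_le hz with h | h
  · by_contra hcon
    exact hzZ (hspec ▸ ⟨hcon, h.symm⟩)
  · exact ⟨_, hA.isResolventAt hT h⟩

/-- The resolvent at a point of the right half-plane is controlled by the one at its projection onto the
imaginary axis. -/
theorem IsGenerator.norm_resolvent_le (hA : IsGenerator T A) (hT : IsBoundedSemigroup T M₀) {z : ℂ}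
    (hz : 0 ≤ z.re) (h : (z.im : ℂ) * Complex.I ∈ resolventSet A) :
    ‖resolvent A z‖ ≤ (1 + M₀) * ‖resolvent A ((z.im : ℂ) * Complex.I)‖ := by
  set Q := resolvent A ((z.im : ℂ) * Complex.I)
  have hM₀ := hT.nonneg
  rcases eq_or_lt_of_le hz with h0 | h0
  · have : z = (z.im : ℂ) * Complex.I := by
      apply Complex.ext <;> simp [← h0]
    nth_rewrite 1 [this]
    nlinarith [norm_nonneg Q]
  · have hR := hA.isResolventAt hT h0
    have hRb := hA.norm_le_of_isResolventAt hT h0 hR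
    rw [hR.resolvent_eq]
    set R := hT.transform (integrableOn_exp_neg_mul h0)
    have h1 := hR.sub_eq (resolvent_spec h)
    have h2 : R = Q + ((z.im : ℂ) * Complex.I - z) • (R * Q) := by rw [← h1]; abel
    have h3 : ‖(z.im : ℂ) * Complex.I - z‖ = z.re := by
      have : (z.im : ℂ) * Complex.I - z = -(z.re : ℂ) := by
        apply Complex.ext <;> simp
      rw [this, norm_neg, Complex.norm_real, Real.norm_eq_abs, abs_of_pos h0]
    calc ‖R‖ = ‖Q + ((z.im : ℂ) * Complex.I - z) • (R * Q)‖ := by rw [← h2]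
      _ ≤ ‖Q‖ + z.re * (M₀ / z.re * ‖Q‖) := by
        refine (norm_add_le _ _).trans (add_le_add le_rfl ?_)
        rw [norm_smul, h3]
        gcongr
        exact (norm_mul_le _ _).trans (by gcongr)
      _ = (1 + M₀) * ‖Q‖ := by field_simp

theorem norm_sub_mul_I_le (z : ℂ) (s : ℝ) : ‖z - (s : ℂ) * Complex.I‖ ≤ |z.re| + |z.im - s| := by
  simpa using Complex.norm_le_abs_re_add_abs_im (z - (s : ℂ) * Complex.I)

theorem abs_im_sub_le_norm (z : ℂ) (s : ℝ) : |z.im - s| ≤ ‖z - (s : ℂ) * Complex.I‖ := by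
  simpa using Complex.abs_im_le_norm (z - (s : ℂ) * Complex.I)

variable {ι : Type*} {ω : ι → ℝ} {d ε M α : ℝ}

theorem mul_I_mem_range_iff {s : ℝ} :
    (s : ℂ) * Complex.I ∈ Set.range (fun k => (ω k : ℂ) * Complex.I) ↔ ∃ k, ω k = s := by
  simp [Complex.I_ne_zero]

/-- The growth of the resolvent near the points `iω k` extends to the right half-plane. -/
theorem norm_resolvent_le_near (hT : IsBoundedSemigroup T M₀) (hA : IsGenerator T A)
    (hspec : spectrum A ∩ {z : ℂ | z.re = 0} = Set.range fun k => (ω k : ℂ) * Complex.I)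
    (hgap : ∀ k l : ι, k ≠ l → d ≤ |ω k - ω l|) (hα : 1 ≤ α) (hM : 0 < M)
    (hnear : ∀ k : ι, ∀ s : ℝ, 0 < |s - ω k| → |s - ω k| ≤ ε →
      |s - ω k| ^ α * ‖resolvent A ((s : ℂ) * Complex.I)‖ ≤ M)
    {r : ℝ} (hrε : r ≤ ε) (hrd : r < d) (hr1 : r ≤ 1) {z : ℂ} (hz : 0 ≤ z.re) (k : ι)
    (hzk : z ≠ (ω k : ℂ) * Complex.I) (hzr : ‖z - (ω k : ℂ) * Complex.I‖ ≤ r) :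
    ‖resolvent A z‖ ≤ ((1 + M₀) * M * 2 ^ α + 2 * M₀) * ‖z - (ω k : ℂ) * Complex.I‖ ^ (-α) := by
  set m := ‖z - (ω k : ℂ) * Complex.I‖ with hm
  have hm0 : 0 < m := norm_pos_iff.2 (sub_ne_zero.2 hzk)
  have hM₀ := hT.nonneg
  have hmle := norm_sub_mul_I_le z (ω k)
  have hbm := abs_im_sub_le_norm z (ω k)
  rw [← hm] at hmle hbm
  rw [abs_of_nonneg hz] at hmle
  set b := |z.im - ω k| with hb
  have hmα : 0 < m ^ (-α) := Real.rpow_pos_of_pos hm0 _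
  rcases le_or_gt z.re b with hab | hab
  · have hb0 : 0 < b := by linarith
    have hmem : (z.im : ℂ) * Complex.I ∈ resolventSet A := by
      refine mem_resolventSet_of_spectrum_eq hT hA hspec (by simp) fun hcon => ?_
      obtain ⟨l, hl⟩ := mul_I_mem_range_iff.1 hcon
      rcases eq_or_ne l k with rfl | hlk
      · rw [hb, hl, sub_self, abs_zero] at hb0
        exact lt_irrefl _ hb0
      · have := hgap l k hlk
        rw [hl, ← hb] at this
        linarith
    have h1 := hnear k z.im hb0 (by linarith)
    rw [← hb] at h1
    have hbα := Real.rpow_pos_of_pos hb0 α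
    have h2 : ‖resolvent A ((z.im : ℂ) * Complex.I)‖ ≤ M * b ^ (-α) := by
      rw [Real.rpow_neg hb0.le, ← div_eq_mul_inv, le_div_iff₀ hbα]
      linarith
    have h3 : b ^ (-α) ≤ 2 ^ α * m ^ (-α) := by
      have : b ^ (-α) ≤ (m / 2) ^ (-α) :=
        Real.rpow_le_rpow_of_nonpos (by linarith) (by linarith) (by linarith)
      rwa [Real.div_rpow hm0.le zero_le_two, Real.rpow_neg zero_le_two, div_inv_eq_mul,
        mul_comm] at this
    calc ‖resolvent A z‖ ≤ (1 + M₀) * (M * (2 ^ α * m ^ (-α))) := by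
          refine (hA.norm_resolvent_le hT hz hmem).trans ?_
          have := h2.trans (mul_le_mul_of_nonneg_left h3 hM.le)
          gcongr
      _ ≤ _ := by
          have : 0 ≤ 2 * M₀ * m ^ (-α) := by positivity
          linarith
  · have ha0 : 0 < z.re := (abs_nonneg _).trans_lt hab
    have hR := hA.isResolventAt hT ha0
    have hle : m⁻¹ ≤ m ^ (-α) := by
      rw [← Real.rpow_neg_one]
      exact Real.rpow_le_rpow_of_exponent_ge hm0 (by linarith) (by linarith)
    calc ‖resolvent A z‖ ≤ M₀ / z.re := by
          rw [hR.resolvent_eq]; exact hA.norm_le_of_isResolventAt hT ha0 hR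
      _ ≤ M₀ / (m / 2) := by gcongr; linarith
      _ = 2 * M₀ * m⁻¹ := by field_simp
      _ ≤ 2 * M₀ * m ^ (-α) := by gcongr
      _ ≤ _ := by
          have : 0 ≤ (1 + M₀) * M * 2 ^ α * m ^ (-α) := by positivity
          linarith

/-- Away from the points `iω k` the resolvent is bounded on the closed right half-plane. -/
theorem norm_resolvent_le_far (hT : IsBoundedSemigroup T M₀) (hA : IsGenerator T A)
    (hspec : spectrum A ∩ {z : ℂ | z.re = 0} = Set.range fun k => (ω k : ℂ) * Complex.I)
    (hα : 0 ≤ α) (hM : 0 < M)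
    (hnear : ∀ k : ι, ∀ s : ℝ, 0 < |s - ω k| → |s - ω k| ≤ ε →
      |s - ω k| ^ α * ‖resolvent A ((s : ℂ) * Complex.I)‖ ≤ M)
    (hfar : ∀ s : ℝ, (∀ k : ι, ε < |s - ω k|) → ‖resolvent A ((s : ℂ) * Complex.I)‖ ≤ M)
    {r : ℝ} (hr : 0 < r) {z : ℂ} (hz : 0 ≤ z.re)
    (hzr : ∀ k, r < ‖z - (ω k : ℂ) * Complex.I‖) :
    ‖resolvent A z‖ ≤ (1 + M₀) * (M + M * (r / 2) ^ (-α)) + M₀ / (r / 2) := by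
  have hM₀ := hT.nonneg
  rcases lt_or_ge z.re (r / 2) with ha | ha
  · have hb : ∀ k, r / 2 < |z.im - ω k| := fun k => by
      have h1 := norm_sub_mul_I_le z (ω k)
      rw [abs_of_nonneg hz] at h1
      linarith [hzr k]
    have hmem : (z.im : ℂ) * Complex.I ∈ resolventSet A := by
      refine mem_resolventSet_of_spectrum_eq hT hA hspec (by simp) fun hcon => ?_
      obtain ⟨l, hl⟩ := mul_I_mem_range_iff.1 hcon
      have := hb l
      rw [hl, sub_self, abs_zero] at this
      linarith
    have hQ : ‖resolvent A ((z.im : ℂ) * Complex.I)‖ ≤ M + M * (r / 2) ^ (-α) := by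
      by_cases h : ∀ k, ε < |z.im - ω k|
      · have : 0 ≤ M * (r / 2) ^ (-α) := by positivity
        linarith [hfar _ h]
      · push Not at h
        obtain ⟨k, hk⟩ := h
        have hb0 : 0 < |z.im - ω k| := by linarith [hb k]
        have h1 := hnear k _ hb0 hk
        have h2 : (r / 2) ^ α ≤ |z.im - ω k| ^ α := by
          have := (hb k).le
          gcongr
        have h3 : 0 < (r / 2) ^ α := by positivity
        have h4 : ‖resolvent A ((z.im : ℂ) * Complex.I)‖ ≤ M * (r / 2) ^ (-α) := by
          rw [Real.rpow_neg (by linarith), ← div_eq_mul_inv, le_div_iff₀ h3, mul_comm]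
          exact (mul_le_mul_of_nonneg_right h2 (norm_nonneg _)).trans h1
        linarith
    calc ‖resolvent A z‖ ≤ (1 + M₀) * (M + M * (r / 2) ^ (-α)) :=
          (hA.norm_resolvent_le hT hz hmem).trans (by gcongr)
      _ ≤ _ := by
          have : 0 ≤ M₀ / (r / 2) := by positivity
          linarith
  · have ha0 : 0 < z.re := by linarith
    have hR := hA.isResolventAt hT ha0
    calc ‖resolvent A z‖ ≤ M₀ / z.re := by
          rw [hR.resolvent_eq]; exact hA.norm_le_of_isResolventAt hT ha0 hR
      _ ≤ M₀ / (r / 2) := by gcongr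
      _ ≤ _ := by
          have : 0 ≤ (1 + M₀) * (M + M * (r / 2) ^ (-α)) := by positivity
          linarith

end HalfPlane

/-! ### The perturbed operator `A + BC` -/

section Perturbation

variable {X : Type*} [NormedAddCommGroup X] [NormedSpace ℂ X]
variable {Y : Type*} [NormedAddCommGroup Y] [NormedSpace ℂ Y]
variable {A : X →ₗ.[ℂ] X} {z : ℂ} {R : X →L[ℂ] X} {B : Y →L[ℂ] X} {C : X →L[ℂ] Y} {Q : Y →L[ℂ] Y}

/-- The Sherman–Morrison–Woodbury formula. -/
theorem IsResolventAt.addBounded (hR : IsResolventAt A z R)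
    (hQ₁ : (1 - (C.comp R).comp B) * Q = 1) (hQ₂ : Q * (1 - (C.comp R).comp B) = 1) :
    IsResolventAt (addBounded A (B.comp C)) z (R + R.comp (B.comp (Q.comp (C.comp R)))) := by
  have h1 : ∀ y, C (R (B (Q y))) = Q y - y := fun y => by
    have := congrArg (fun P : Y →L[ℂ] Y => P y) hQ₁
    simp only [mul_apply_eq_comp, sub_apply, one_apply_eq_self, ContinuousLinearMap.comp_apply] at this
    exact eq_sub_of_add_eq (sub_eq_iff_eq_add'.1 this).symm
  have h2 : ∀ y, Q (C (R (B y))) = Q y - y := fun y => by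
    have := congrArg (fun P : Y →L[ℂ] Y => P y) hQ₂
    simp only [mul_apply_eq_comp, sub_apply, one_apply_eq_self, ContinuousLinearMap.comp_apply,
      map_sub] at this
    exact eq_sub_of_add_eq (sub_eq_iff_eq_add'.1 this).symm
  rw [isResolventAt_iff]
  refine ⟨fun x => ?_, fun u v huv => ?_⟩
  · rw [mem_graph_addBounded]
    have h3 := hR.mem_graph (x + B (Q (C (R x))))
    have h4 : (R + R.comp (B.comp (Q.comp (C.comp R)))) x = R (x + B (Q (C (R x)))) := by
      rw [map_add]; rfl
    rw [h4]
    convert h3 using 2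
    rw [ContinuousLinearMap.comp_apply, map_add R, map_add C, h1, add_sub_cancel]
    abel
  · rw [mem_graph_addBounded] at huv
    have h3 := hR.apply_sub huv
    have h4 : R (z • u - v) = u - R (B (C u)) := by
      rw [eq_sub_iff_add_eq, ← map_add]
      convert h3 using 2
      rw [ContinuousLinearMap.comp_apply]; abel
    simp only [add_apply, ContinuousLinearMap.comp_apply]
    rw [h4, map_sub, map_sub, h2, sub_sub_cancel, sub_add_cancel]

theorem isUnit_one_sub_of_norm_le [CompleteSpace Y] {P : Y →L[ℂ] Y} (hP : ‖P‖ ≤ 1 / 2) :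
    IsUnit (1 - P) ∧ ‖Ring.inverse (1 - P)‖ ≤ 2 := by
  have hlt : ‖P‖ < 1 := by linarith
  have hu : IsUnit (1 - P) := (Units.oneSub P hlt).isUnit
  refine ⟨hu, ?_⟩
  set Q := Ring.inverse (1 - P)
  have h1 : (1 - P) * Q = 1 := Ring.mul_inverse_cancel _ hu
  have h2 : Q = 1 + P * Q := by rw [← h1, sub_mul, one_mul]; abel
  have h3 : ‖Q‖ ≤ 1 + 1 / 2 * ‖Q‖ := by
    calc ‖Q‖ = ‖1 + P * Q‖ := by rw [← h2]
      _ ≤ 1 + 1 / 2 * ‖Q‖ := by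
        refine (norm_add_le _ _).trans (add_le_add ContinuousLinearMap.norm_id_le ?_)
        exact (norm_mul_le _ _).trans (by gcongr)
  linarith

variable [CompleteSpace X]

/-- If `I - C R(λ) B` has uniformly bounded inverses as `λ → iω` from the right, then `iω` is not an
eigenvalue of `A + BC`: for an eigenvector `u` one has `(I - C R B) C u = C μ R u` and
`u = μ R u + R B C u` with `R = R(iω + μ)`, and `μ R u → 0` by strong stability. -/
theorem notMem_pointSpectrum_addBounded {T : ℝ → X →L[ℂ] X} {M₀ : ℝ} (hT : IsBoundedSemigroup T M₀)
    (hA : IsGenerator T A) (hs : IsStronglyStable T) (ω K : ℝ)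
    (hK : ∀ μ : ℝ, 0 < μ →
      IsUnit (1 - (C.comp (resolvent A ((ω : ℂ) * Complex.I + μ))).comp B) ∧
      ‖Ring.inverse (1 - (C.comp (resolvent A ((ω : ℂ) * Complex.I + μ))).comp B)‖ ≤ K) :
    (ω : ℂ) * Complex.I ∉ pointSpectrum (addBounded A (B.comp C)) := by
  rintro ⟨u, hu0, hu⟩
  apply hu0
  set x : X := (u : X)
  have hgraph : (x, ((ω : ℂ) * Complex.I) • x - B (C x)) ∈ A.graph := by
    have : (x, ((ω : ℂ) * Complex.I) • x) ∈ (addBounded A (B.comp C)).graph :=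
      hu ▸ LinearPMap.mem_graph _ u
    simpa using mem_graph_addBounded.1 this
  have hTω := hT.rescale (z := (ω : ℂ) * Complex.I) (by simp)
  set S : ℝ → X →L[ℂ] X := fun t => Complex.exp (-((ω : ℂ) * Complex.I * t)) • T t with hSdef
  have hAω : IsGenerator S (-(shift ((ω : ℂ) * Complex.I) A)) := hA.rescale _
  have hnorm : ∀ t, ‖S t x‖ = ‖T t x‖ := fun t => by
    rw [hSdef, smul_apply, norm_smul, Complex.norm_exp]
    simp
  have hS0 : Tendsto (fun t => S t x) atTop (𝓝 0) := by
    rw [tendsto_zero_iff_norm_tendsto_zero]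
    simp only [hnorm]
    exact tendsto_zero_iff_norm_tendsto_zero.1 (hs x)
  have hlim := hTω.tendsto_smul_transform (x := x) (y := 0) (l := 𝓝[>] 0) self_mem_nhdsWithin
    fun t ht => hS0.comp (tendsto_inv_nhdsGT_zero.const_mul_atTop ht)
  have hlim' : Tendsto (fun μ : ℝ => (μ : ℂ) • resolvent A ((ω : ℂ) * Complex.I + μ) x) (𝓝[>] 0)
      (𝓝 0) := by
    refine hlim.congr' ?_
    filter_upwards [self_mem_nhdsWithin] with μ hμ
    have hμ0 : 0 < μ := hμ
    have hz : 0 < ((ω : ℂ) * Complex.I + μ).re := by simpa using hμ0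
    have h1 := (resolvent_spec (A := A) ⟨_, hA.isResolventAt hT hz⟩)
    have h2 := (IsResolventAt.shift (by rwa [add_comm] at h1) :
      IsResolventAt (-(shift ((ω : ℂ) * Complex.I) A)) μ _)
    have h3 := hAω.isResolventAt hTω (z := μ) (by simpa using hμ0)
    rw [add_comm, h2.unique h3]
    rfl
  have hid : ∀ μ : ℝ, 0 < μ → (μ : ℂ) • resolvent A ((ω : ℂ) * Complex.I + μ) x
      + resolvent A ((ω : ℂ) * Complex.I + μ) (B (C x)) = x := by
    intro μ hμ
    have hz : 0 < ((ω : ℂ) * Complex.I + μ).re := by simpa using hμ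
    have h1 := (resolvent_spec (A := A) ⟨_, hA.isResolventAt hT hz⟩).apply_sub hgraph
    rw [← map_smul, ← map_add]
    convert h1 using 2
    rw [add_smul]; abel
  have hCx : C x = 0 := by
    have hle : ∀ᶠ μ : ℝ in 𝓝[>] 0,
        ‖C x‖ ≤ K * ‖C ((μ : ℂ) • resolvent A ((ω : ℂ) * Complex.I + μ) x)‖ := by
      filter_upwards [self_mem_nhdsWithin] with μ hμ
      obtain ⟨hunit, hb⟩ := hK μ hμ
      have h1 := Ring.inverse_mul_cancel _ hunit
      set Q := Ring.inverse (1 - (C.comp (resolvent A ((ω : ℂ) * Complex.I + μ))).comp B)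
      have h2 := congrArg (fun P : Y →L[ℂ] Y => P (C x)) h1
      simp only [mul_apply_eq_comp, sub_apply, one_apply_eq_self,
        ContinuousLinearMap.comp_apply] at h2
      have h3 : C x - C (resolvent A ((ω : ℂ) * Complex.I + μ) (B (C x)))
          = C ((μ : ℂ) • resolvent A ((ω : ℂ) * Complex.I + μ) x) := by
        rw [sub_eq_iff_eq_add, ← map_add, hid μ hμ]
      rw [h3] at h2
      nth_rewrite 1 [← h2]
      exact Q.le_of_opNorm_le hb _
    have h4 := (((C.continuous.tendsto 0).comp hlim').norm.const_mul K)
    rw [map_zero, norm_zero, mul_zero] at h4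
    exact norm_le_zero_iff.1 (ge_of_tendsto h4 hle)
  have hconst : Tendsto (fun μ : ℝ => (μ : ℂ) • resolvent A ((ω : ℂ) * Complex.I + μ) x) (𝓝[>] 0)
      (𝓝 x) := by
    refine tendsto_const_nhds.congr' ?_
    filter_upwards [self_mem_nhdsWithin] with μ hμ
    have := hid μ hμ
    rw [hCx, map_zero, map_zero, add_zero] at this
    exact this.symm
  exact tendsto_nhds_unique hconst hlim'

end Perturbation

section Gain

variable {X : Type*} [NormedAddCommGroup X] [InnerProductSpace ℂ X] [CompleteSpace X]
variable {Y : Type*} [NormedAddCommGroup Y] [NormedSpace ℂ Y]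

theorem norm_dualAdjoint_le (C : X →L[ℂ] Y) (f : StrongDual ℂ Y) :
    ‖dualAdjoint C f‖ ≤ ‖C‖ * ‖f‖ := by
  rw [dualAdjoint, LinearIsometryEquiv.norm_map, mul_comm]
  exact ContinuousLinearMap.opNorm_comp_le _ _

theorem inner_eq_of_mem_graph_shift {A : X →ₗ.[ℂ] X} (hA : Dense (A.domain : Set X)) (ω : ℝ)
    {x y x' y' : X} (h : (x, y) ∈ (-(shift ((ω : ℂ) * Complex.I) A)).graph)
    (h' : (x', y') ∈ (-(shift (-((ω : ℂ) * Complex.I)) A.adjoint)).graph) :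
    inner ℂ y x' = inner ℂ x y' := by
  rw [mem_graph_neg_shift, LinearPMap.mem_graph_iff] at h h'
  obtain ⟨u, hu, hu'⟩ := h
  obtain ⟨v, hv, hv'⟩ := h'
  have h1 := LinearPMap.adjoint_isFormalAdjoint hA v u
  simp only at hu hu' hv hv'
  rw [hu, hu', hv, hv'] at h1
  have h2 : inner ℂ (y + ((ω : ℂ) * Complex.I) • x) x'
      = inner ℂ x (y' + -((ω : ℂ) * Complex.I) • x') := by
    rw [← inner_conj_symm, ← h1, inner_conj_symm]
  rw [inner_add_left, inner_add_right, inner_smul_left, inner_smul_right] at h2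
  simp only [map_mul, Complex.conj_ofReal, Complex.conj_I, mul_neg] at h2
  exact add_right_cancel h2

/-- If the form `⟪C* f, R B y⟫` is bounded by `K` times the norms of `B y`, `C* f` and of the components
`D y`, `D' f`, then `C R B` is small for small `B`, `C`, `D`, `D'`. -/
theorem norm_comp_resolvent_comp_le {R : X →L[ℂ] X} {B D : Y →L[ℂ] X} {C : X →L[ℂ] Y}
    {D' : StrongDual ℂ Y →SL[starRingEnd ℂ] X} {K δ : ℝ} (hK : 0 ≤ K) (hδ : 0 ≤ δ) (hB : ‖B‖ ≤ δ)
    (hC : ‖C‖ ≤ δ) (hD : ‖D‖ ≤ δ) (hD' : ‖D'‖ ≤ δ)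
    (h : ∀ (y : Y) (f : StrongDual ℂ Y), ‖inner ℂ (dualAdjoint C f) (R (B y))‖ ≤
      K * (‖B y‖ * ‖dualAdjoint C f‖ + ‖D y‖ * ‖D' f‖)) :
    ‖(C.comp R).comp B‖ ≤ 2 * K * δ ^ 2 := by
  refine ContinuousLinearMap.opNorm_le_bound _ (by positivity) fun y => ?_
  refine NormedSpace.norm_le_dual_bound ℂ _ (by positivity) fun f => ?_
  have h1 := h y f
  rw [inner_dualAdjoint] at h1
  have hb : ‖B y‖ ≤ δ * ‖y‖ := B.le_of_opNorm_le hB y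
  have hd : ‖D y‖ ≤ δ * ‖y‖ := D.le_of_opNorm_le hD y
  have hc : ‖dualAdjoint C f‖ ≤ δ * ‖f‖ :=
    (norm_dualAdjoint_le C f).trans (by gcongr)
  have he : ‖D' f‖ ≤ δ * ‖f‖ := D'.le_of_opNorm_le hD' f
  calc _ ≤ K * (‖B y‖ * ‖dualAdjoint C f‖ + ‖D y‖ * ‖D' f‖) := h1
    _ ≤ K * (δ * ‖y‖ * (δ * ‖f‖) + δ * ‖y‖ * (δ * ‖f‖)) := by gcongr
    _ = _ := by ring

end Gain

end OpSemigroup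

end

theorem theorem3
    {X : Type*} [NormedAddCommGroup X] [InnerProductSpace ℂ X] [CompleteSpace X]
    -- the generator of a strongly stable semigroup
    (A : X →ₗ.[ℂ] X) (T : ℝ → X →L[ℂ] X)
    (hT : OpSemigroup.IsC0Semigroup T) (hA : OpSemigroup.IsGenerator T A)
    (hstable : OpSemigroup.IsStronglyStable T)
    -- the imaginary spectrum: uniformly separated points, finitely or countably many
    {ι : Type*} (ω : ι → ℝ)
    (hspec : OpSemigroup.spectrum A ∩ {z : ℂ | z.re = 0} =
      Set.range fun k => (ω k : ℂ) * Complex.I)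
    (hgap : ∃ d : ℝ, 0 < d ∧ ∀ k l : ι, k ≠ l → d ≤ |ω k - ω l|)
    -- growth of the resolvent
    (β γ : ℝ) (hβ : 0 ≤ β) (hγ : 0 ≤ γ) (hα : 1 ≤ β + γ)
    (M ε : ℝ) (hM : 0 < M) (hε : 0 < ε)
    (hnear : ∀ k : ι, ∀ s : ℝ, 0 < |s - ω k| → |s - ω k| ≤ ε →
      |s - ω k| ^ (β + γ) * ‖OpSemigroup.resolvent A ((s : ℂ) * Complex.I)‖ ≤ M)
    (hfar : ∀ s : ℝ, (∀ k : ι, ε < |s - ω k|) →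
      ‖OpSemigroup.resolvent A ((s : ℂ) * Complex.I)‖ ≤ M) :
    ∃ δ : ℝ, 0 < δ ∧
      ∀ (Y : Type*) [NormedAddCommGroup Y] [NormedSpace ℂ Y] [CompleteSpace Y]
        (B : Y →L[ℂ] X) (C : X →L[ℂ] Y),
        ‖B‖ < δ → ‖C‖ < δ →
        (∀ k : ι, ∃ D : Y →L[ℂ] X,
          OpSemigroup.IsNegPowComp A (ω k) β B D ∧ ‖D‖ < δ) →
        (∀ k : ι, ∃ D : StrongDual ℂ Y →SL[starRingEnd ℂ] X,
          OpSemigroup.IsNegPowCompAdjoint A (ω k) γ C D ∧ ‖D‖ < δ) →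
        ({z : ℂ | 0 ≤ z.re} \ Set.range fun k => (ω k : ℂ) * Complex.I) ⊆
            OpSemigroup.resolventSet (OpSemigroup.addBounded A (B.comp C)) ∧
        (∀ k : ι, (ω k : ℂ) * Complex.I ∉
            OpSemigroup.pointSpectrum (OpSemigroup.addBounded A (B.comp C))) ∧
        ∃ K : ℝ, ∀ z ∈ ({z : ℂ | 0 ≤ z.re} \ Set.range fun k => (ω k : ℂ) * Complex.I),
          z ∈ OpSemigroup.resolventSet A ∧
          IsUnit (1 - (C.comp (OpSemigroup.resolvent A z)).comp B) ∧
          ‖Ring.inverse (1 - (C.comp (OpSemigroup.resolvent A z)).comp B)‖ ≤ K := by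
  obtain ⟨M₀, hM₀, hTb⟩ := hstable.exists_isBoundedSemigroup hT
  obtain ⟨d, hd, hgap⟩ := hgap
  have hAdense := hA.dense_domain hTb
  set r := min (min ε (d / 2)) 1 with hr
  have hr0 : 0 < r := lt_min (lt_min hε (by linarith)) one_pos
  have hrε : r ≤ ε := (min_le_left _ _).trans (min_le_left _ _)
  have hrd : r < d := ((min_le_left _ _).trans (min_le_right _ _)).trans_lt (by linarith)
  have hr1 : r ≤ 1 := min_le_right _ _
  set M₁ := (1 + M₀) * M * 2 ^ (β + γ) + 2 * M₀
  set M₂ := (1 + M₀) * (M + M * (r / 2) ^ (-(β + γ))) + M₀ / (r / 2)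
  have hM₁ : 0 ≤ M₁ := by positivity
  have hM₂ : 0 ≤ M₂ := by positivity
  obtain ⟨K, hK0, hK⟩ :=
    OpSemigroup.exists_bound_inner_resolvent (X := X) M₀ M₁ hM₁ (β := β) (γ := γ) hα
  -- with this `δ`, both `2 K δ ^ 2` and `M₂ δ ^ 2` are at most `1 / 2`
  set L := 2 * K + M₂ + 1 with hL
  have hL1 : 1 ≤ L := by linarith
  have hδ0 : 0 < 1 / (2 * L) := by positivity
  have hδL : L * (1 / (2 * L)) ^ 2 ≤ 1 / 2 := by
    have : L * (1 / (2 * L)) ^ 2 = 1 / (4 * L) := by field_simp; norm_num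
    rw [this]
    exact one_div_le_one_div_of_le two_pos (by linarith)
  refine ⟨1 / (2 * L), hδ0, ?_⟩
  set δ := 1 / (2 * L)
  intro Y _ _ _ B C hB hC hD hD'
  have hmem : ∀ z ∈ ({z : ℂ | 0 ≤ z.re} \ Set.range fun k => (ω k : ℂ) * Complex.I),
      z ∈ OpSemigroup.resolventSet A := fun z hz =>
    OpSemigroup.mem_resolventSet_of_spectrum_eq hTb hA hspec hz.1 hz.2
  have hgain : ∀ z ∈ ({z : ℂ | 0 ≤ z.re} \ Set.range fun k => (ω k : ℂ) * Complex.I),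
      ‖(C.comp (OpSemigroup.resolvent A z)).comp B‖ ≤ 1 / 2 := by
    intro z hz
    have hRz := OpSemigroup.resolvent_spec (hmem z hz)
    by_cases hfarz : ∀ k, r < ‖z - (ω k : ℂ) * Complex.I‖
    · have hRM := OpSemigroup.norm_resolvent_le_far hTb hA hspec (by linarith) hM hnear hfar hr0
        hz.1 hfarz
      calc ‖(C.comp (OpSemigroup.resolvent A z)).comp B‖ ≤ δ * M₂ * δ := by
            refine (ContinuousLinearMap.opNorm_comp_le _ _).trans ?_
            refine mul_le_mul ((ContinuousLinearMap.opNorm_comp_le _ _).trans ?_) hB.le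
              (norm_nonneg _) (by positivity)
            exact mul_le_mul hC.le hRM (norm_nonneg _) hδ0.le
        _ = M₂ * δ ^ 2 := by ring
        _ ≤ L * δ ^ 2 := by gcongr; linarith
        _ ≤ 1 / 2 := hδL
    · push Not at hfarz
      obtain ⟨k, hk⟩ := hfarz
      have hzk : z ≠ (ω k : ℂ) * Complex.I := fun h => hz.2 ⟨k, h.symm⟩
      have hRM := OpSemigroup.norm_resolvent_le_near hTb hA hspec hgap hα hM hnear hrε hrd hr1
        hz.1 k hzk hk
      obtain ⟨D, hDB, hDδ⟩ := hD k
      obtain ⟨D', hDC, hDδ'⟩ := hD' k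
      have hshift : OpSemigroup.IsResolventAt (-(OpSemigroup.shift ((ω k : ℂ) * Complex.I) A))
          (z - (ω k : ℂ) * Complex.I) (OpSemigroup.resolvent A z) := by
        refine OpSemigroup.IsResolventAt.shift ?_
        rwa [sub_add_cancel]
      have hle := OpSemigroup.norm_comp_resolvent_comp_le (R := OpSemigroup.resolvent A z) hK0 hδ0.le
        hB.le hC.le hDδ.le hDδ'.le fun y f =>
          hK _ _ (OpSemigroup.shift (-((ω k : ℂ) * Complex.I)) A.adjoint)
            (hTb.rescale (z := (ω k : ℂ) * Complex.I) (by simp)) (hA.rescale _)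
            (fun x y x' y' h h' => OpSemigroup.inner_eq_of_mem_graph_shift hAdense (ω k) h h')
            _ _ (sub_ne_zero.2 hzk) (hk.trans hr1) hshift hRM _ _ _ _ (hDB y) (hDC f)
      calc _ ≤ 2 * K * δ ^ 2 := hle
        _ ≤ L * δ ^ 2 := by gcongr; linarith
        _ ≤ 1 / 2 := hδL
  refine ⟨fun z hz => ?_, fun k => ?_, 2, fun z hz => ⟨hmem z hz, ?_⟩⟩
  · obtain ⟨hu, -⟩ := OpSemigroup.isUnit_one_sub_of_norm_le (hgain z hz)
    exact ⟨_, (OpSemigroup.resolvent_spec (hmem z hz)).addBounded (Ring.mul_inverse_cancel _ hu)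
      (Ring.inverse_mul_cancel _ hu)⟩
  · refine OpSemigroup.notMem_pointSpectrum_addBounded hTb hA hstable (ω k) 2 fun μ hμ =>
      OpSemigroup.isUnit_one_sub_of_norm_le (hgain _ ⟨?_, ?_⟩)
    · simpa using hμ.le
    · rintro ⟨l, hl⟩
      have := congrArg Complex.re hl
      simp at this
      exact hμ.ne this
  · exact OpSemigroup.isUnit_one_sub_of_norm_le (hgain z hz)
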